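/- Let $p$ be a prime, $k=\overline{\mathbb F}_p$, $n\ge 0$ and $G=\mathrm{GL}_n(k)$. Let $T\subset B\subset G$ be the subgroups of diagonal and of upper triangular matrices, and $U\subset B$ the subgroup of upper triangular matrices with all diagonal entries equal to $1$. For $\lambda=(\lambda_1,\dots,\lambda_n)\in\mathbb Z^n$, view $\lambda$ as the character $\mathrm{diag}(t_1,\dots,t_n)\mapsto t_1^{\lambda_1}\cdots t_n^{\lambda_n}$ of $T$, and extend it to $B$ so that it is trivial on $U$. Let $$\operatorname{Ind}_B^G\lambda=\{f:G\to k \text{ algebraic}\;:\; f(bg)=\lambda(b)f(g)\ \text{ for all } b\in B,\ g\in G\},$$ where algebraic functions are the elements of $k[x_{ij},\det^{-1}]$, and let $G$ act on it by right translation. Let $W=N(T)/T$ be the Weyl group, acting on characters of $T$ by $(w\chi)(t)=\chi(w^{-1}tw)$; the positive roots are the characters $t_i/t_j$ with $i<j$, and the negative roots their inverses. A character $t_1^{m_1}\cdots t_n^{m_n}$ with integers $m_i$ is dominant integral if $m_1\ge\cdots\ge m_n$. Then: 1. $\operatorname{Ind}_B^G\lambda$ is a finite-dimensional $k$-vector space.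 There is a unique $w_0\in W$ that takes all positive roots to negative roots; it satisfies $w_0(\lambda)=(\lambda_n,\dots,\lambda_1)$; and $\operatorname{Ind}_B^G\lambda\neq 0$ if and only if $w_0(\lambda)$ is dominant integral. 2. If $\operatorname{Ind}_B^G\lambda\ne 0$, then it has a unique $U$-fixed vector up to scalars: the space $(\operatorname{Ind}_B^G\lambda)^U$ is one-dimensional. 3. If $\operatorname{Ind}_B^G\lambda\ne 0$, then it has a unique irreducible $G$-submodule $L_\lambda$. -/

import Mathlib

noncomputable section

open Matrix

namespace GLInd

variable {n : ℕ} {k : Type*} [Field k]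

theorem upper_inv {g : GL (Fin n) k} (hg : (g : Matrix (Fin n) (Fin n) k).IsUpperTriangular) :
    ((g⁻¹ : GL (Fin n) k) : Matrix (Fin n) (Fin n) k).IsUpperTriangular := by
  have : Invertible (g : Matrix (Fin n) (Fin n) k) := g.invertible
  rw [Matrix.coe_units_inv]
  exact blockTriangular_inv_of_blockTriangular hg

theorem upper_mul_diag {A C : Matrix (Fin n) (Fin n) k} (hA : A.IsUpperTriangular)
    (hC : C.IsUpperTriangular) (i : Fin n) : (A * C) i i = A i i * C i i := by
  rw [Matrix.mul_apply, Finset.sum_eq_single i]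
  · intro j _ hj
    rcases lt_or_gt_of_ne hj with h | h
    · rw [hA h, zero_mul]
    · rw [hC h, mul_zero]
  · simp

theorem diag_mul {A C : Matrix (Fin n) (Fin n) k} (hA : A.IsDiag) (hC : C.IsDiag) :
    (A * C).IsDiag := by
  rw [← hA.diagonal_diag, ← hC.diagonal_diag, Matrix.diagonal_mul_diagonal]
  exact isDiag_diagonal _

theorem diag_upper {A : Matrix (Fin n) (Fin n) k} (hA : A.IsDiag) : A.IsUpperTriangular :=
  fun _ _ h => hA (ne_of_gt h)

theorem diag_inv {g : GL (Fin n) k} (hg : (g : Matrix (Fin n) (Fin n) k).IsDiag) :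
    ((g⁻¹ : GL (Fin n) k) : Matrix (Fin n) (Fin n) k).IsDiag := by
  rw [Matrix.coe_units_inv, ← hg.diagonal_diag, Matrix.inv_diagonal]
  exact isDiag_diagonal _

variable (n k) in
/-- The Borel subgroup `B` of invertible upper triangular matrices. -/
def borel : Subgroup (GL (Fin n) k) where
  carrier := {g | (g : Matrix (Fin n) (Fin n) k).IsUpperTriangular}
  one_mem' := by
    change ((1 : GL (Fin n) k) : Matrix (Fin n) (Fin n) k).IsUpperTriangular
    rw [Units.val_one]
    exact blockTriangular_one
  mul_mem' {a b} ha hb := by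
    change ((a * b : GL (Fin n) k) : Matrix (Fin n) (Fin n) k).IsUpperTriangular
    rw [Units.val_mul]
    exact BlockTriangular.mul ha hb
  inv_mem' hg := upper_inv hg

variable (n k) in
/-- The group `U` of upper triangular unipotent matrices. -/
def unipotent : Subgroup (GL (Fin n) k) where
  carrier := {g | (g : Matrix (Fin n) (Fin n) k).IsUpperTriangular ∧
    ∀ i, (g : Matrix (Fin n) (Fin n) k) i i = 1}
  one_mem' := ⟨(borel n k).one_mem, fun i => by simp⟩
  mul_mem' {a b} ha hb := ⟨(borel n k).mul_mem ha.1 hb.1, fun i => by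
    rw [Units.val_mul, upper_mul_diag ha.1 hb.1, ha.2, hb.2, one_mul]⟩
  inv_mem' {g} hg := ⟨upper_inv hg.1, fun i => by
    have h := upper_mul_diag hg.1 (upper_inv hg.1) i
    rw [← Units.val_mul, mul_inv_cancel, hg.2, one_mul] at h
    simpa using h.symm⟩

variable (n k) in
/-- The maximal torus `T` of invertible diagonal matrices. -/
def torus : Subgroup (GL (Fin n) k) where
  carrier := {g | (g : Matrix (Fin n) (Fin n) k).IsDiag}
  one_mem' := by
    change ((1 : GL (Fin n) k) : Matrix (Fin n) (Fin n) k).IsDiag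
    rw [Units.val_one]
    exact isDiag_one
  mul_mem' {a b} ha hb := by
    change ((a * b : GL (Fin n) k) : Matrix (Fin n) (Fin n) k).IsDiag
    rw [Units.val_mul]
    exact diag_mul ha hb
  inv_mem' hg := diag_inv hg

theorem torus_le_borel : torus n k ≤ borel n k := fun _ h => diag_upper h

theorem unipotent_le_borel : unipotent n k ≤ borel n k := fun _ h => h.1

/-- The character of `B` attached to `l = (l₁, …, lₙ) ∈ ℤⁿ`: it is `b ↦ b₁₁ ^ l₁ ⋯ bₙₙ ^ lₙ`, that is,
the character of `T` attached to `l`, extended trivially on `U`. As `B` is a group, a monoid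
homomorphism to `k` is the same as a homomorphism to `kˣ`. -/
def borelChar (l : Fin n → ℤ) : borel n k →* k where
  toFun b := ∏ i, ((b : GL (Fin n) k) : Matrix (Fin n) (Fin n) k) i i ^ l i
  map_one' := by simp
  map_mul' a b := by
    rw [← Finset.prod_mul_distrib]
    refine Finset.prod_congr rfl fun i _ => ?_
    rw [Subgroup.coe_mul, Units.val_mul, upper_mul_diag a.2 b.2, mul_zpow]

/-- The character `diag (t₁, …, tₙ) ↦ t₁ ^ l₁ ⋯ tₙ ^ lₙ` of `T`. -/
def torusChar (l : Fin n → ℤ) : torus n k →* k where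
  toFun t := ∏ i, ((t : GL (Fin n) k) : Matrix (Fin n) (Fin n) k) i i ^ l i
  map_one' := by simp
  map_mul' a b := by
    rw [← Finset.prod_mul_distrib]
    refine Finset.prod_congr rfl fun i _ => ?_
    rw [Subgroup.coe_mul, Units.val_mul, upper_mul_diag (diag_upper a.2) (diag_upper b.2),
      mul_zpow]

theorem borelChar_torus (l : Fin n → ℤ) :
    (borelChar l).comp (Subgroup.inclusion torus_le_borel) = torusChar (k := k) l := rfl

theorem borelChar_unipotent (l : Fin n → ℤ) (u : unipotent n k) :
    borelChar l (Subgroup.inclusion unipotent_le_borel u) = 1 := by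
  change ∏ i, ((u : GL (Fin n) k) : Matrix (Fin n) (Fin n) k) i i ^ l i = 1
  refine Finset.prod_eq_one fun i _ => ?_
  rw [u.2.2 i, _root_.one_zpow]

variable (n k) in
/-- The algebra `k[G] = k[xᵢⱼ, det⁻¹]` of algebraic functions on `G = GLₙ(k)`. -/
def algFun : Subalgebra k (GL (Fin n) k → k) :=
  Algebra.adjoin k
    (Set.range (fun (ij : Fin n × Fin n) (g : GL (Fin n) k) =>
        (g : Matrix (Fin n) (Fin n) k) ij.1 ij.2) ∪
      {fun g : GL (Fin n) k => ((g : Matrix (Fin n) (Fin n) k).det)⁻¹})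

/-- Right translation of functions on `G` by `g`. -/
def rightTrans (g : GL (Fin n) k) : (GL (Fin n) k → k) →ₐ[k] (GL (Fin n) k → k) where
  toFun f x := f (x * g)
  map_one' := rfl
  map_mul' _ _ := rfl
  map_zero' := rfl
  map_add' _ _ := rfl
  commutes' _ := rfl

theorem rightTrans_mem (g : GL (Fin n) k) {f : GL (Fin n) k → k} (hf : f ∈ algFun n k) :
    rightTrans g f ∈ algFun n k := by
  suffices h : algFun n k ≤ (algFun n k).comap (rightTrans g) from h hf
  refine Algebra.adjoin_le ?_
  rintro _ (⟨⟨i, j⟩, rfl⟩ | rfl)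
  · have h : rightTrans g (fun x => (x : Matrix (Fin n) (Fin n) k) i j) =
        ∑ m, (g : Matrix (Fin n) (Fin n) k) m j •
          (fun x : GL (Fin n) k => (x : Matrix (Fin n) (Fin n) k) i m) := by
      ext x
      change ((x * g : GL (Fin n) k) : Matrix (Fin n) (Fin n) k) i j = _
      simp [Matrix.mul_apply, mul_comm]
    change rightTrans g (fun x => (x : Matrix (Fin n) (Fin n) k) i j) ∈ algFun n k
    rw [h]
    exact sum_mem fun m _ =>
      Subalgebra.smul_mem (algFun n k) (Algebra.subset_adjoin (Set.mem_union_left _ ⟨(i, m), rfl⟩)) _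
  · have h : rightTrans g (fun x => ((x : Matrix (Fin n) (Fin n) k).det)⁻¹) =
        ((g : Matrix (Fin n) (Fin n) k).det)⁻¹ •
          (fun x : GL (Fin n) k => ((x : Matrix (Fin n) (Fin n) k).det)⁻¹) := by
      ext x
      change (((x * g : GL (Fin n) k) : Matrix (Fin n) (Fin n) k).det)⁻¹ = _
      simp [mul_comm]
    change rightTrans g (fun x => ((x : Matrix (Fin n) (Fin n) k).det)⁻¹) ∈ algFun n k
    rw [h]
    exact Subalgebra.smul_mem (algFun n k) (Algebra.subset_adjoin (Set.mem_union_right _ rfl)) _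

variable (k) in
/-- `Ind_B^G l`: the algebraic functions `f` on `G` with `f (b g) = l(b) f(g)` for `b ∈ B`. -/
def ind (l : Fin n → ℤ) : Submodule k (GL (Fin n) k → k) where
  carrier := {f | f ∈ algFun n k ∧
    ∀ (b : borel n k) (g : GL (Fin n) k), f ((b : GL (Fin n) k) * g) = borelChar l b * f g}
  zero_mem' := ⟨zero_mem _, fun b g => by simp⟩
  add_mem' hf hf' := ⟨add_mem hf.1 hf'.1, fun b g => by simp [hf.2, hf'.2, mul_add]⟩
  smul_mem' c f hf := ⟨Subalgebra.smul_mem _ hf.1 c, fun b g => by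
    simp only [Pi.smul_apply, smul_eq_mul, hf.2]
    ring⟩

variable (k) in
/-- The action of `G` on `Ind_B^G l` by right translation. -/
def indRep (l : Fin n → ℤ) : Representation k (GL (Fin n) k) (ind k l) where
  toFun g := (rightTrans g).toLinearMap.restrict (p := ind k l) (q := ind k l) fun f hf =>
    ⟨rightTrans_mem g hf.1, fun b x => by
      change f (b * x * g) = borelChar l b * f (x * g)
      rw [mul_assoc, hf.2]⟩
  map_one' := by
    ext f x
    change f.1 (x * 1) = f.1 x
    rw [mul_one]
  map_mul' g h := by
    ext f x
    change f.1 (x * (g * h)) = f.1 (x * g * h)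
    rw [mul_assoc]

variable (n k) in
/-- The Weyl group `W = N(T)/T`. -/
abbrev Weyl : Type _ :=
  ↥(Subgroup.normalizer (torus n k : Set (GL (Fin n) k))) ⧸
    (torus n k).subgroupOf (Subgroup.normalizer (torus n k : Set (GL (Fin n) k)))

/-- The action of `W` on `T` by conjugation, `w t w⁻¹`. -/
def weylConj : Weyl n k →* MulAut (torus n k) :=
  QuotientGroup.lift _ (torus n k).normalizerMonoidHom (by
    intro x hx
    rw [Subgroup.normalizerMonoidHom_ker, Subgroup.mem_subgroupOf,
      Subgroup.mem_centralizer_iff]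
    intro t ht
    have hx' : ((x : GL (Fin n) k) : Matrix (Fin n) (Fin n) k).IsDiag := hx
    have ht' : (t : Matrix (Fin n) (Fin n) k).IsDiag := ht
    apply Units.ext
    rw [Units.val_mul, Units.val_mul, ← hx'.diagonal_diag, ← ht'.diagonal_diag,
      Matrix.diagonal_mul_diagonal, Matrix.diagonal_mul_diagonal]
    congr 1
    ext i
    exact mul_comm _ _)

/-- The action of `W` on the characters of `T`: `(w χ)(t) = χ(w⁻¹ t w)`. -/
def weylAct (w : Weyl n k) (χ : torus n k →* k) : torus n k →* k :=
  χ.comp (weylConj w⁻¹).toMonoidHom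

/-- The positive roots, that is, the roots of `T` in `B`: the characters `tᵢ / tⱼ` with `i < j`. -/
def IsPosRoot (χ : torus n k →* k) : Prop :=
  ∃ i j : Fin n, i < j ∧ χ = torusChar (Pi.single i 1 - Pi.single j 1)

/-- The negative roots: the characters `tⱼ / tᵢ` with `i < j`. -/
def IsNegRoot (χ : torus n k →* k) : Prop :=
  ∃ i j : Fin n, i < j ∧ χ = torusChar (Pi.single j 1 - Pi.single i 1)

/-- `w` takes all positive roots to negative roots. -/
def IsLongest (w : Weyl n k) : Prop :=
  ∀ χ : torus n k →* k, IsPosRoot χ → IsNegRoot (weylAct w χ)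

/-- `χ` is dominant integral: `χ = t₁ ^ m₁ ⋯ tₙ ^ mₙ` with integers `m₁ ≥ ⋯ ≥ mₙ`. -/
def IsDominant (χ : torus n k →* k) : Prop :=
  ∃ m : Fin n → ℤ, Antitone m ∧ χ = torusChar m

end GLInd

end

/-! Everything is controlled by the big cell `B w₀ U`, where `w₀` is the matrix reversing the basis.
It contains every matrix at which finitely many nonzero minor polynomials do not vanish, so it is
dense, and a function in the induced module is determined by its restriction to `w₀ U`
(`eq_zero_of_vanishes_on_revGL_mul`). A `U`-fixed function is then determined by its value at `w₀`,
so the fixed space has dimension at most one.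

If `l` is weakly increasing, a product of powers of corner minors is a fixed vector with value 1 at
`w₀` (`highestVector_mem`). If `l j < l i` for some `i < j`, an identity in the `SL₂` of the pair
`(i, j)` equates a polynomial in `c` times a positive power of `c` with a polynomial in `c⁻¹`, and
this kills every `f` (`apply_eq_zero_of_lt`).

Unipotence of `U` puts a fixed vector in every nonzero submodule: for a suitable weighted degree on
functions on `U`, translation changes a function only in lower degree, so a nonzero vector of
minimal degree is fixed (`exists_fixed_vector`). Hence the highest weight vector lies in every
nonzero submodule, and the submodule it generates is the only irreducible one.

For finite dimension, write `f = P / det ^ N`. Equivariance makes `P` vanish on singular matrices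
when `N` is large, so irreducibility of the determinant and the Nullstellensatz let a factor `det`
cancel. This bounds `N` in terms of `l`, and scalar matrices then fix the degree of `P`. -/

noncomputable section

open Matrix

namespace GLInd

/-! ### Irreducibility of the generic determinant -/

section Determinant

variable {m : Type*} [Fintype m] [DecidableEq m] {k : Type*} [Field k]

/-- The substitution multiplying the variables in `S` by a new variable. -/
def scaleVars {σ : Type*} (S : Set σ) [DecidablePred (· ∈ S)] :
    MvPolynomial σ k →ₐ[k] Polynomial (MvPolynomial σ k) :=
  MvPolynomial.aeval fun x =>
    if x ∈ S then Polynomial.C (MvPolynomial.X x) * Polynomial.X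
    else Polynomial.C (MvPolynomial.X x)

theorem eval_scaleVars {σ : Type*} (S : Set σ) [DecidablePred (· ∈ S)] (a : MvPolynomial σ k)
    (x : σ → k) (c : k) :
    MvPolynomial.eval x ((scaleVars S a).eval (MvPolynomial.C c)) =
      MvPolynomial.eval (fun i => if i ∈ S then x i * c else x i) a := by
  induction a using MvPolynomial.induction_on with
  | C r => simp [scaleVars, ← MvPolynomial.algebraMap_eq, Polynomial.algebraMap_apply]
  | add p q hp hq => simp only [map_add, Polynomial.eval_add, hp, hq]
  | mul_X p i hp =>
    simp only [map_mul, Polynomial.eval_mul, hp, MvPolynomial.eval_X]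
    congr 1
    simp only [scaleVars, MvPolynomial.aeval_X]
    split_ifs <;> simp

/-- A polynomial whose evaluations do not depend on the variables in `S`. -/
def IndepOf {σ : Type*} (S : Set σ) (a : MvPolynomial σ k) : Prop :=
  ∀ x y : σ → k, (∀ i ∉ S, x i = y i) → MvPolynomial.eval x a = MvPolynomial.eval y a

theorem indepOf_of_natDegree_scaleVars {σ : Type*} (S : Set σ) [DecidablePred (· ∈ S)]
    {a : MvPolynomial σ k} (h : (scaleVars S a).natDegree = 0) : IndepOf S a := by
  have key : ∀ x : σ → k, MvPolynomial.eval x a =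
      MvPolynomial.eval (fun i => if i ∈ S then x i * 0 else x i) a := by
    intro x
    -- A polynomial constant in the new variable has equal values at 1, which gives back `a`, and at
    -- 0, which erases the variables in `S`.
    have h1 := eval_scaleVars S a x 1
    have h0 := eval_scaleVars S a x 0
    rw [Polynomial.eq_C_of_natDegree_eq_zero h, Polynomial.eval_C] at h0 h1
    rw [← h0, h1]
    simp
  intro x y hxy
  rw [key x, key y]
  congr 2
  ext i
  split_ifs with hi
  · simp
  · exact hxy i hi

/-- Degrees in the new variable add over a domain, and `d` has degree one, so one factor has degree
zero. This is applied to rows and columns of the determinant. -/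
theorem indepOf_or_of_mul {σ : Type*} (S : Set σ) [DecidablePred (· ∈ S)]
    {a b d : MvPolynomial σ k} (hab : a * b = d) (hd0 : d ≠ 0)
    (hd : scaleVars S d = Polynomial.C d * Polynomial.X) : IndepOf S a ∨ IndepOf S b := by
  have h : scaleVars S a * scaleVars S b = Polynomial.C d * Polynomial.X := by
    rw [← map_mul, hab, hd]
  have hne : Polynomial.C d * (Polynomial.X : Polynomial (MvPolynomial σ k)) ≠ 0 :=
    mul_ne_zero (by simpa using hd0) Polynomial.X_ne_zero
  have hdeg := congrArg Polynomial.natDegree h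
  rw [Polynomial.natDegree_C_mul_X _ hd0, Polynomial.natDegree_mul] at hdeg
  · rcases Nat.eq_zero_or_pos (scaleVars S a).natDegree with h0 | h0
    · exact Or.inl (indepOf_of_natDegree_scaleVars S h0)
    · exact Or.inr (indepOf_of_natDegree_scaleVars S (by omega))
  · rintro h0; rw [h0, zero_mul] at h; exact hne h.symm
  · rintro h0; rw [h0, mul_zero] at h; exact hne h.symm

theorem scaleVars_row_det (i : m) [DecidablePred (· ∈ {x : m × m | x.1 = i})] :
    scaleVars {x : m × m | x.1 = i} (mvPolynomialX m m k).det =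
      Polynomial.C (mvPolynomialX m m k).det * Polynomial.X := by
  rw [AlgHom.map_det]
  have : (scaleVars {x : m × m | x.1 = i}).mapMatrix (mvPolynomialX m m k) =
      diagonal (Function.update 1 i Polynomial.X) *
        (Polynomial.C : MvPolynomial (m × m) k →+* _).mapMatrix (mvPolynomialX m m k) := by
    ext1 a b
    rw [Matrix.diagonal_mul]
    simp only [AlgHom.mapMatrix_apply, Matrix.map_apply, mvPolynomialX_apply, scaleVars,
      MvPolynomial.aeval_X, RingHom.mapMatrix_apply, Set.mem_ofPred_eq]
    by_cases h : a = i
    · subst h; rw [mul_comm]; simp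
    · simp [h]
  rw [this, det_mul, det_diagonal, ← RingHom.map_det, Finset.prod_update_of_mem (Finset.mem_univ _)]
  rw [mul_comm]; simp

theorem scaleVars_col_det (j : m) [DecidablePred (· ∈ {x : m × m | x.2 = j})] :
    scaleVars {x : m × m | x.2 = j} (mvPolynomialX m m k).det =
      Polynomial.C (mvPolynomialX m m k).det * Polynomial.X := by
  rw [AlgHom.map_det]
  have : (scaleVars {x : m × m | x.2 = j}).mapMatrix (mvPolynomialX m m k) =
      (Polynomial.C : MvPolynomial (m × m) k →+* _).mapMatrix (mvPolynomialX m m k) *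
        diagonal (Function.update 1 j Polynomial.X) := by
    ext1 a b
    rw [Matrix.mul_diagonal]
    simp only [AlgHom.mapMatrix_apply, Matrix.map_apply, mvPolynomialX_apply, scaleVars,
      MvPolynomial.aeval_X, RingHom.mapMatrix_apply, Set.mem_ofPred_eq]
    by_cases h : b = j
    · subst h; simp
    · simp [h]
  rw [this, det_mul, det_diagonal, ← RingHom.map_det, Finset.prod_update_of_mem (Finset.mem_univ _)]
  simp

theorem not_indepOf_row_col {a b : MvPolynomial (m × m) k}
    (hab : a * b = (mvPolynomialX m m k).det) (i j : m)
    (ha : IndepOf {x : m × m | x.2 = j} a) (hb : IndepOf {x : m × m | x.1 = i} b) : False := by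
  -- The only nonzero entry in row `i` of this permutation matrix lies in column `j`. Erasing it is
  -- invisible both to `a` and to `b`, yet it makes an invertible matrix singular.
  set A : Matrix m m k := (Equiv.swap i j).permMatrix k with hA
  have hval : ∀ B : Matrix m m k, MvPolynomial.eval (fun x : m × m => B x.1 x.2) a *
      MvPolynomial.eval (fun x : m × m => B x.1 x.2) b = B.det := by
    intro B
    rw [← map_mul, hab, eval_det_mvPolynomialX]
    rfl
  have hB0 : (A.updateRow i 0).det = 0 := det_eq_zero_of_row_eq_zero i (by simp)
  have h1 : MvPolynomial.eval (fun x : m × m => A x.1 x.2) a =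
      MvPolynomial.eval (fun x : m × m => A.updateRow i 0 x.1 x.2) a := by
    refine ha _ _ fun x hx => ?_
    by_cases h : x.1 = i
    · rw [h, updateRow_self, hA, Equiv.Perm.permMatrix, PEquiv.toMatrix_apply]
      simp only [Equiv.toPEquiv_apply, Equiv.swap_apply_left]
      rw [if_neg]
      · rfl
      · intro h'
        simp only [Option.mem_def, Option.some.injEq] at h'
        exact hx h'.symm
    · rw [updateRow_ne h]
  have h2 : MvPolynomial.eval (fun x : m × m => A x.1 x.2) b =
      MvPolynomial.eval (fun x : m × m => A.updateRow i 0 x.1 x.2) b :=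
    hb _ _ fun x hx => by rw [updateRow_ne hx]
  have h3 : A.det = 0 := by rw [← hval, h1, h2, hval, hB0]
  rw [hA, det_permutation] at h3
  rcases Int.units_eq_one_or (Equiv.Perm.sign (Equiv.swap i j)) with h | h <;> simp [h] at h3

/-- Rows can be set to zero one at a time without changing the value, so `a` is the constant `a(0)`.
-/
theorem isUnit_of_indepOf_rows [Infinite k] {a : MvPolynomial (m × m) k} (h0 : a ≠ 0)
    (h : ∀ i, IndepOf {x : m × m | x.1 = i} a) : IsUnit a := by
  have hrows : ∀ (s : Finset m) (x : m × m → k),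
      MvPolynomial.eval x a = MvPolynomial.eval (fun y => if y.1 ∈ s then 0 else x y) a := by
    intro s
    induction s using Finset.induction_on with
    | empty => intro x; simp
    | insert i s hi ih =>
      intro x
      rw [ih x]
      refine h i _ _ fun y hy => ?_
      have : y.1 ≠ i := hy
      simp [this]
  have hC : a = MvPolynomial.C (MvPolynomial.eval 0 a) := by
    refine MvPolynomial.funext fun x => ?_
    rw [hrows Finset.univ x, MvPolynomial.eval_C]
    simp [Pi.zero_def]
  rw [hC] at h0 ⊢
  refine (IsUnit.mk0 _ fun h' => h0 ?_).map MvPolynomial.C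
  rw [h', map_zero]

/-- The generic determinant is irreducible. -/
theorem irreducible_det_mvPolynomialX [Nonempty m] [Infinite k] :
    Irreducible (mvPolynomialX m m k).det := by
  classical
  have hne := det_mvPolynomialX_ne_zero m k
  refine ⟨fun hu => ?_, fun {a b} hab => ?_⟩
  · have := hu.map (MvPolynomial.eval (0 : m × m → k))
    rw [eval_det_mvPolynomialX] at this
    refine this.ne_zero ?_
    obtain ⟨i⟩ := ‹Nonempty m›
    exact det_eq_zero_of_row_eq_zero i (by simp)
  · have ha0 : a ≠ 0 := by rintro rfl; exact hne (by rw [hab, zero_mul])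
    have hb0 : b ≠ 0 := by rintro rfl; exact hne (by rw [hab, mul_zero])
    by_contra! hcon
    obtain ⟨i, hi⟩ := not_forall.1 fun h => hcon.1 (isUnit_of_indepOf_rows ha0 h)
    obtain ⟨i', hi'⟩ := not_forall.1 fun h => hcon.2 (isUnit_of_indepOf_rows hb0 h)
    -- If both factors are nonunits, each depends on some row, which the other factor then ignores.
    -- Whichever factor ignores column `i` contradicts the row ignored by its partner.
    have hbi := (indepOf_or_of_mul _ hab.symm hne (scaleVars_row_det i)).resolve_left hi
    have hai' := (indepOf_or_of_mul _ hab.symm hne (scaleVars_row_det i')).resolve_right hi'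
    rcases indepOf_or_of_mul _ hab.symm hne (scaleVars_col_det i) with h | h
    · exact not_indepOf_row_col hab.symm i i h hbi
    · exact not_indepOf_row_col ((mul_comm b a).trans hab.symm) i' i h hai'

/-- A polynomial vanishing on all singular matrices is divisible by the determinant. -/
theorem det_dvd_of_vanishes [Nonempty m] [IsAlgClosed k] {P : MvPolynomial (m × m) k}
    (hP : ∀ A : Matrix m m k, A.det = 0 → MvPolynomial.eval (fun x => A x.1 x.2) P = 0) :
    (mvPolynomialX m m k).det ∣ P := by
  have : Infinite k := IsAlgClosed.instInfinite
  have hprime : Prime (mvPolynomialX m m k).det := irreducible_det_mvPolynomialX.prime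
  have hI : (Ideal.span {(mvPolynomialX m m k).det}).IsPrime :=
    (Ideal.span_singleton_prime hprime.ne_zero).2 hprime
  -- Nullstellensatz: a prime ideal is the vanishing ideal of its zero locus, here the singular
  -- matrices.
  rw [← Ideal.mem_span_singleton,
    ← MvPolynomial.IsPrime.vanishingIdeal_zeroLocus (K := k) (Ideal.span _)]
  intro x hx
  have hd := hx _ (Ideal.mem_span_singleton_self _)
  rw [MvPolynomial.aeval_eq_eval] at hd ⊢
  exact hP (Matrix.of fun i j => x (i, j)) ((eval_det_mvPolynomialX m k x).symm.trans hd)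

end Determinant

/-! ### Bounded poles and finite dimension -/

section FiniteDimension

variable {n : ℕ} {k : Type*} [Field k]

theorem exists_zpow_ne_one [Infinite k] {z : ℤ} (hz : z ≠ 0) : ∃ s : k, s ≠ 0 ∧ s ^ z ≠ 1 := by
  have key : ∀ m : ℕ, m ≠ 0 → ∃ s : k, s ≠ 0 ∧ s ^ m ≠ 1 := by
    intro m hm
    by_contra! h
    have h0 : (Polynomial.X * (Polynomial.X ^ m - 1) : Polynomial k) = 0 := by
      refine Polynomial.funext fun s => ?_
      by_cases hs : s = 0
      · simp [hs]
      · simp [h s hs]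
    have h1 : (Polynomial.X ^ m - 1 : Polynomial k) = 0 :=
      (mul_eq_zero.1 h0).resolve_left Polynomial.X_ne_zero
    exact Polynomial.X_pow_sub_C_ne_zero (Nat.pos_of_ne_zero hm) (1 : k) (by simpa using h1)
  obtain ⟨s, hs, h⟩ := key z.natAbs (Int.natAbs_ne_zero.2 hz)
  refine ⟨s, hs, fun h' => h ?_⟩
  rcases Int.natAbs_eq z with hz' | hz'
  · rw [hz', zpow_natCast] at h'
    exact h'
  · rw [hz', _root_.zpow_neg, zpow_natCast, inv_eq_one] at h'
    exact h'

theorem prod_zpow_eq_zpow_sum {ι : Type*} {s : k} (hs : s ≠ 0) (S : Finset ι) (e : ι → ℤ) :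
    ∏ i ∈ S, s ^ e i = s ^ ∑ i ∈ S, e i := by
  classical
  induction S using Finset.induction_on with
  | empty => simp
  | insert i S hi ih => rw [Finset.prod_insert hi, Finset.sum_insert hi, zpow_add₀ hs, ih]

/-- Evaluation of a polynomial in the matrix entries at a matrix. -/
abbrev evalMat (A : Matrix (Fin n) (Fin n) k) (P : MvPolynomial (Fin n × Fin n) k) : k :=
  MvPolynomial.eval (fun x => A x.1 x.2) P

theorem evalMat_det (A : Matrix (Fin n) (Fin n) k) :
    evalMat A (mvPolynomialX (Fin n) (Fin n) k).det = A.det :=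
  eval_det_mvPolynomialX _ _ _

theorem exists_mul_det_pow_eq {f : GL (Fin n) k → k} (hf : f ∈ algFun n k) :
    ∃ (N : ℕ) (P : MvPolynomial (Fin n × Fin n) k), ∀ g : GL (Fin n) k,
      f g * (g : Matrix (Fin n) (Fin n) k).det ^ N = evalMat g P := by
  have hdet : ∀ g : GL (Fin n) k, (g : Matrix (Fin n) (Fin n) k).det ≠ 0 := fun g =>
    g.det_ne_zero
  induction hf using Algebra.adjoin_induction with
  | mem f hf =>
    rcases hf with ⟨x, rfl⟩ | rfl
    · exact ⟨0, MvPolynomial.X x, fun g => by simp⟩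
    · exact ⟨1, 1, fun g => by simp [hdet g]⟩
  | algebraMap r => exact ⟨0, MvPolynomial.C r, fun g => by simp⟩
  | add f f' _ _ h h' =>
    obtain ⟨N, P, h⟩ := h
    obtain ⟨N', P', h'⟩ := h'
    refine ⟨N + N', P * (mvPolynomialX (Fin n) (Fin n) k).det ^ N' +
      P' * (mvPolynomialX (Fin n) (Fin n) k).det ^ N, fun g => ?_⟩
    have hd := evalMat_det (g : Matrix (Fin n) (Fin n) k)
    simp only [evalMat] at hd h h' ⊢
    rw [map_add, map_mul, map_mul, map_pow, map_pow, hd, ← h, ← h', Pi.add_apply]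
    ring
  | mul f f' _ _ h h' =>
    obtain ⟨N, P, h⟩ := h
    obtain ⟨N', P', h'⟩ := h'
    refine ⟨N + N', P * P', fun g => ?_⟩
    simp only [evalMat] at h h' ⊢
    rw [map_mul, ← h, ← h', Pi.mul_apply]
    ring

/-- Equivariance of the numerator of a function in `Ind_B^G l`, on all matrices. -/
theorem evalMat_borel_mul [Infinite k] {l : Fin n → ℤ} {f : GL (Fin n) k → k} (hf : f ∈ ind k l)
    {N : ℕ} {P : MvPolynomial (Fin n × Fin n) k}
    (hP : ∀ g : GL (Fin n) k, f g * (g : Matrix (Fin n) (Fin n) k).det ^ N = evalMat g P)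
    (b : borel n k) (A : Matrix (Fin n) (Fin n) k) :
    evalMat (((b : GL (Fin n) k) : Matrix (Fin n) (Fin n) k) * A) P =
      borelChar l b * ((b : GL (Fin n) k) : Matrix (Fin n) (Fin n) k).det ^ N * evalMat A P := by
  set M : Matrix (Fin n) (Fin n) k := ((b : GL (Fin n) k) : Matrix (Fin n) (Fin n) k) with hM
  set Q : MvPolynomial (Fin n × Fin n) k := MvPolynomial.bind₁
    (fun x => ∑ j, MvPolynomial.C (M x.1 j) * MvPolynomial.X (j, x.2)) P with hQ
  have hQe : ∀ C : Matrix (Fin n) (Fin n) k, evalMat C Q = evalMat (M * C) P := by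
    intro C
    simp only [evalMat, hQ, MvPolynomial.eval, MvPolynomial.eval₂Hom_bind₁]
    congr 2
    ext x
    simp [Matrix.mul_apply]
  -- Equivariance of `f` gives this on invertible matrices, and over an infinite field a polynomial
  -- is determined there.
  have hQP : Q = MvPolynomial.C (borelChar l b * M.det ^ N) * P := by
    refine MvPolynomial.eq_of_eval_eq_on_gl fun g => ?_
    rw [map_mul, MvPolynomial.eval_C]
    change evalMat _ Q = _ * evalMat _ P
    rw [hQe, hM, ← Units.val_mul, ← hP, ← hP, hf.2, Units.val_mul, det_mul]
    ring
  rw [← hQe, hQP, evalMat, map_mul, MvPolynomial.eval_C]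

theorem borel_of_upper {A : Matrix (Fin n) (Fin n) k} (hA : A.IsUpperTriangular)
    (hd : ∀ i, A i i ≠ 0) :
    ∃ b : borel n k, ((b : GL (Fin n) k) : Matrix (Fin n) (Fin n) k) = A :=
  ⟨⟨GeneralLinearGroup.mkOfDetNeZero A (by
    rw [det_of_isUpperTriangular hA]; exact Finset.prod_ne_zero_iff.2 fun i _ => hd i), hA⟩, rfl⟩

/-- Row operations from `U` preserve the value and can create a zero row `i` in a singular matrix.
Scaling that row by `s` changes nothing, yet multiplies the value by `s ^ (l i + N)`, a nontrivial
power. -/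
theorem evalMat_eq_zero_of_det_eq_zero [Infinite k] {l : Fin n → ℤ} {f : GL (Fin n) k → k}
    (hf : f ∈ ind k l) {N : ℕ} {P : MvPolynomial (Fin n × Fin n) k}
    (hP : ∀ g : GL (Fin n) k, f g * (g : Matrix (Fin n) (Fin n) k).det ^ N = evalMat g P)
    (hN : ∀ i, 0 < l i + N) {A : Matrix (Fin n) (Fin n) k} (hA : A.det = 0) :
    evalMat A P = 0 := by
  classical
  obtain ⟨c, hc0, hc⟩ := exists_vecMul_eq_zero_iff.2 hA
  obtain ⟨i, hi, hmin⟩ : ∃ i, c i ≠ 0 ∧ ∀ j < i, c j = 0 := by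
    have hne : (Finset.univ.filter fun i => c i ≠ 0).Nonempty := by
      obtain ⟨i, hi⟩ := Function.ne_iff.1 hc0
      exact ⟨i, by simpa using hi⟩
    refine ⟨_, (Finset.mem_filter.1 (Finset.min'_mem _ hne)).2, fun j hj => ?_⟩
    by_contra h
    exact absurd (Finset.min'_le _ j (Finset.mem_filter.2 ⟨Finset.mem_univ _, h⟩)) (not_le.2 hj)
  -- Row `i` of `u` is the left kernel vector `c`, normalized at its first nonzero entry; that
  -- choice of `i` makes `u` upper triangular.
  obtain ⟨u, hu⟩ := borel_of_upper
    (A := (1 : Matrix (Fin n) (Fin n) k).updateRow i ((c i)⁻¹ • c))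
    (by
      intro a b hab
      have hab : b < a := hab
      by_cases h : a = i
      · subst h
        simp [hmin b hab]
      · rw [updateRow_ne h, one_apply_ne hab.ne'])
    (by
      intro a
      by_cases h : a = i
      · subst h
        simp [hi]
      · simp [updateRow_ne h])
  have hdiag : ∀ a, ((u : GL (Fin n) k) : Matrix (Fin n) (Fin n) k) a a = 1 := by
    intro a
    rw [hu]
    by_cases h : a = i
    · subst h
      simp [hi]
    · simp [updateRow_ne h]
  have huA := evalMat_borel_mul hf hP u A
  have hchar : borelChar l u = 1 := by
    change ∏ a, ((u : GL (Fin n) k) : Matrix (Fin n) (Fin n) k) a a ^ l a = 1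
    simp [hdiag]
  have hudet : ((u : GL (Fin n) k) : Matrix (Fin n) (Fin n) k).det = 1 := by
    rw [det_of_isUpperTriangular u.2]
    simp [hdiag]
  rw [hchar, hudet, one_pow, one_mul, one_mul] at huA
  rw [← huA]
  set A' := ((u : GL (Fin n) k) : Matrix (Fin n) (Fin n) k) * A with hA'
  have hrow : ∀ j, A' i j = 0 := by
    intro j
    have := congrFun hc j
    rw [hA', hu, mul_apply]
    simp only [updateRow_self, Pi.smul_apply, smul_eq_mul, mul_assoc]
    rw [← Finset.mul_sum]
    simp only [vecMul, dotProduct, Pi.zero_apply] at this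
    rw [this, mul_zero]
  obtain ⟨s, hs0, hs⟩ := exists_zpow_ne_one (k := k) (hN i).ne'
  obtain ⟨t, ht⟩ := borel_of_upper (A := diagonal (Function.update (1 : Fin n → k) i s))
    (diag_upper (isDiag_diagonal _))
    (by
      intro a
      rw [diagonal_apply_eq]
      by_cases h : a = i
      · subst h; simpa using hs0
      · simp [h])
  have htA : ((t : GL (Fin n) k) : Matrix (Fin n) (Fin n) k) * A' = A' := by
    rw [ht]
    ext a j
    rw [diagonal_mul]
    by_cases h : a = i
    · subst h; simp [hrow]
    · simp [h]
  have h2 := evalMat_borel_mul hf hP t A'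
  have hchar' : borelChar l t = s ^ l i := by
    change ∏ a, ((t : GL (Fin n) k) : Matrix (Fin n) (Fin n) k) a a ^ l a = _
    rw [ht, Finset.prod_eq_single i]
    · simp
    · intro b _ hb; simp [hb]
    · simp
  have htdet : ((t : GL (Fin n) k) : Matrix (Fin n) (Fin n) k).det = s := by
    rw [ht, det_diagonal, Finset.prod_update_of_mem (Finset.mem_univ _)]
    simp
  rw [htA, hchar', htdet, ← zpow_natCast, ← zpow_add₀ hs0] at h2
  by_contra hne
  exact hs (mul_right_cancel₀ hne (by rw [one_mul, ← h2]))

/-- A uniform bound for the order of the pole along `det`. -/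
theorem exists_mul_det_pow_eq_of_mem_ind [IsAlgClosed k] [Nonempty (Fin n)] {l : Fin n → ℤ} {N₀ : ℕ}
    (hN₀ : ∀ i, 0 ≤ l i + N₀) {f : GL (Fin n) k → k} (hf : f ∈ ind k l) :
    ∃ P : MvPolynomial (Fin n × Fin n) k, ∀ g : GL (Fin n) k,
      f g * (g : Matrix (Fin n) (Fin n) k).det ^ N₀ = evalMat g P := by
  have : Infinite k := IsAlgClosed.instInfinite
  have descent : ∀ d : ℕ, (∃ P : MvPolynomial (Fin n × Fin n) k, ∀ g : GL (Fin n) k,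
      f g * (g : Matrix (Fin n) (Fin n) k).det ^ (N₀ + d) = evalMat g P) →
      ∃ P : MvPolynomial (Fin n × Fin n) k, ∀ g : GL (Fin n) k,
        f g * (g : Matrix (Fin n) (Fin n) k).det ^ N₀ = evalMat g P := by
    intro d
    induction d with
    | zero => exact id
    | succ d ih =>
      rintro ⟨P, hP⟩
      refine ih ?_
      -- With exponent `N₀ + d + 1` every `l i + N` is strictly positive, so one factor `det`
      -- cancels.
      obtain ⟨Q, rfl⟩ := det_dvd_of_vanishes fun A hA =>
        evalMat_eq_zero_of_det_eq_zero hf hP (fun i => by have := hN₀ i; push_cast; omega) hA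
      refine ⟨Q, fun g => mul_right_cancel₀ g.det_ne_zero ?_⟩
      rw [mul_assoc, ← pow_succ, add_assoc, hP, evalMat, map_mul, mul_comm]
      congr 1
      exact evalMat_det _
  obtain ⟨N, P, hP⟩ := exists_mul_det_pow_eq hf.1
  refine descent N ⟨P * (mvPolynomialX (Fin n) (Fin n) k).det ^ N₀, fun g => ?_⟩
  rw [evalMat, map_mul, map_pow]
  change _ = evalMat _ P * evalMat _ _ ^ N₀
  rw [evalMat_det, ← hP]
  ring

/-- For fixed `x`, `P (s • x)` is a polynomial in `s` whose coefficients are the values of the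
homogeneous components; compare it with `s ^ D * P x`. -/
theorem isHomogeneous_of_eval_smul [Infinite k] {σ : Type*} {P : MvPolynomial σ k} {D : ℕ}
    (h : ∀ (s : k) (x : σ → k), s ≠ 0 →
      MvPolynomial.eval (s • x) P = s ^ D * MvPolynomial.eval x P) :
    P.IsHomogeneous D := by
  have hcomp : ∀ d, d ≠ D → MvPolynomial.homogeneousComponent d P = 0 := by
    intro d hd
    refine MvPolynomial.funext fun x => ?_
    set q : Polynomial k := ∑ e ∈ Finset.range (P.totalDegree + 1),
      Polynomial.C (MvPolynomial.eval x (MvPolynomial.homogeneousComponent e P)) *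
        Polynomial.X ^ e with hq
    have hqe : ∀ s, q.eval s = MvPolynomial.eval (s • x) P := by
      intro s
      conv_rhs => rw [← MvPolynomial.sum_homogeneousComponent P, map_sum]
      rw [hq, Polynomial.eval_finsetSum]
      refine Finset.sum_congr rfl fun e _ => ?_
      have := (MvPolynomial.homogeneousComponent_isHomogeneous e P)
      simp only [Polynomial.eval_mul, Polynomial.eval_C, Polynomial.eval_pow, Polynomial.eval_X]
      rw [MvPolynomial.eval_eq, MvPolynomial.eval_eq, Finset.sum_mul]
      refine Finset.sum_congr rfl fun a ha => ?_
      have hdeg := this.degree_eq_sum_deg_support ha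
      simp only [Pi.smul_apply, smul_eq_mul, mul_pow, Finset.prod_mul_distrib]
      rw [Finset.prod_pow_eq_pow_sum, hdeg]
      ring
    -- The factor `X` absorbs the value `s = 0`, which the hypothesis excludes.
    have hzero : Polynomial.X * (q - Polynomial.C (MvPolynomial.eval x P) * Polynomial.X ^ D) = 0 := by
      refine Polynomial.funext fun s => ?_
      by_cases hs : s = 0
      · simp [hs]
      · simp [hqe, h s x hs, mul_comm (MvPolynomial.eval x P)]
    have hq' := sub_eq_zero.1 ((mul_eq_zero.1 hzero).resolve_left Polynomial.X_ne_zero)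
    have hc := congrArg (fun r => Polynomial.coeff r d) hq'
    simp only [hq, Polynomial.finsetSum_coeff, Polynomial.coeff_C_mul, Polynomial.coeff_X_pow,
      mul_ite, mul_one, mul_zero, if_neg hd, Finset.sum_ite_eq, Finset.mem_range] at hc
    split_ifs at hc with hr
    · simpa using hc
    · rw [MvPolynomial.homogeneousComponent_eq_zero _ _ (by omega)]
  rw [← MvPolynomial.sum_homogeneousComponent P]
  refine MvPolynomial.IsHomogeneous.sum _ _ _ fun d _ => ?_
  by_cases hd : d = D
  · subst hd; exact MvPolynomial.homogeneousComponent_isHomogeneous _ _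
  · rw [hcomp d hd]; exact MvPolynomial.isHomogeneous_zero _ _ _

theorem finite_ind [IsAlgClosed k] (l : Fin n → ℤ) : Module.Finite k (ind k l) := by
  have : Infinite k := IsAlgClosed.instInfinite
  rcases isEmpty_or_nonempty (Fin n) with hn | hn
  -- For `n = 0` the generic determinant is 1, so the divisibility argument is unavailable, but the
  -- group is trivial.
  · have : Finite (GL (Fin n) k) :=
      have : Subsingleton (GL (Fin n) k) := Units.val_injective.subsingleton
      inferInstance
    infer_instance
  obtain ⟨N₀, hN₀⟩ : ∃ N₀ : ℕ, ∀ i, 0 ≤ l i + N₀ := by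
    refine ⟨∑ i, (l i).natAbs, fun i => ?_⟩
    have := Finset.single_le_sum (f := fun i => (l i).natAbs) (fun _ _ => Nat.zero_le _)
      (Finset.mem_univ i)
    have : (l i).natAbs ≤ ∑ i, (l i).natAbs := this
    omega
  set D : ℕ := (∑ i, (l i + N₀)).toNat with hD
  have hD' : (D : ℤ) = ∑ i, (l i + N₀) := Int.toNat_of_nonneg (Finset.sum_nonneg fun i _ => hN₀ i)
  set Ψ : MvPolynomial (Fin n × Fin n) k →ₗ[k] (GL (Fin n) k → k) :=
    { toFun P g := evalMat g P * ((g : Matrix (Fin n) (Fin n) k).det ^ N₀)⁻¹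
      map_add' P Q := by ext g; simp [evalMat, add_mul]
      map_smul' c P := by ext g; simp [evalMat, MvPolynomial.smul_eval, mul_assoc] } with hΨ
  have hle : ind k l ≤ (MvPolynomial.homogeneousSubmodule (Fin n × Fin n) k D).map Ψ := by
    intro f hf
    obtain ⟨P, hP⟩ := exists_mul_det_pow_eq_of_mem_ind hN₀ hf
    refine ⟨P, ?_, ?_⟩
    · refine isHomogeneous_of_eval_smul fun s x hs => ?_
      obtain ⟨t, ht⟩ := borel_of_upper (A := diagonal (fun _ : Fin n => s))
        (diag_upper (isDiag_diagonal _)) (fun i => by simpa using hs)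
      have h := evalMat_borel_mul hf hP t (Matrix.of fun i j => x (i, j))
      have hchar' : borelChar l t = s ^ ∑ i, l i := by
        change ∏ a, ((t : GL (Fin n) k) : Matrix (Fin n) (Fin n) k) a a ^ l a = _
        rw [ht, ← prod_zpow_eq_zpow_sum hs]
        simp
      have hx : (fun y : Fin n × Fin n =>
          (diagonal (fun _ : Fin n => s) * Matrix.of fun i j => x (i, j)) y.1 y.2) = s • x := by
        ext y
        simp
      rw [hchar', ht, det_diagonal, evalMat, hx] at h
      rw [h]
      congr 1
      rw [← zpow_natCast s D, hD', Finset.sum_add_distrib, zpow_add₀ hs]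
      congr 1
      simp only [Finset.prod_const, Finset.sum_const, Finset.card_univ, Fintype.card_fin, ← pow_mul,
        nsmul_eq_mul]
      exact_mod_cast rfl
    · ext g
      change evalMat g P * _ = _
      rw [← hP, mul_inv_cancel_right₀ (pow_ne_zero _ g.det_ne_zero)]
  have : Module.Finite k (MvPolynomial.homogeneousSubmodule (Fin n × Fin n) k D) :=
    Module.Finite.iff_fg.2 (MvPolynomial.homogeneousSubmodule_fg _ _ _)
  exact Submodule.finiteDimensional_of_le hle

end FiniteDimension

/-! ### The big cell and its density -/

section BigCell

variable {n : ℕ} {k : Type*} [Field k]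

theorem rev_submatrix_mul {R : Type*} [CommRing R] (A : Matrix (Fin n) (Fin n) R) :
    (1 : Matrix (Fin n) (Fin n) R).submatrix Fin.rev id * A = A.submatrix Fin.rev id := by
  ext i j
  simp [Matrix.mul_apply, Matrix.one_apply]

theorem mul_rev_submatrix {R : Type*} [CommRing R] (A : Matrix (Fin n) (Fin n) R) :
    A * (1 : Matrix (Fin n) (Fin n) R).submatrix Fin.rev id = A.submatrix id Fin.rev := by
  ext i j
  simp [Matrix.mul_apply, Matrix.one_apply, Fin.rev_eq_iff]

variable (n k) in
/-- The permutation matrix of `i ↦ n + 1 - i`, representing the longest element of `W`. -/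
def revGL : GL (Fin n) k where
  val := (1 : Matrix (Fin n) (Fin n) k).submatrix Fin.rev id
  inv := (1 : Matrix (Fin n) (Fin n) k).submatrix Fin.rev id
  val_inv := by
    rw [rev_submatrix_mul]
    ext i j
    simp [Matrix.one_apply]
  inv_val := by
    rw [rev_submatrix_mul]
    ext i j
    simp [Matrix.one_apply]

theorem revGL_mul_apply (A : Matrix (Fin n) (Fin n) k) (i j : Fin n) :
    ((revGL n k : Matrix (Fin n) (Fin n) k) * A) i j = A i.rev j :=
  congrFun (congrFun (rev_submatrix_mul A) i) j

theorem mul_revGL_apply (A : Matrix (Fin n) (Fin n) k) (i j : Fin n) :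
    (A * (revGL n k : Matrix (Fin n) (Fin n) k)) i j = A i j.rev :=
  congrFun (congrFun (mul_rev_submatrix A) i) j

theorem revGL_inv : (revGL n k)⁻¹ = revGL n k := rfl

theorem revGL_mul_revGL : revGL n k * revGL n k = 1 :=
  mul_inv_cancel (revGL n k)

theorem revGL_submatrix :
    (revGL n k : Matrix (Fin n) (Fin n) k).submatrix Fin.rev id = 1 := by
  ext i j
  change (1 : Matrix (Fin n) (Fin n) k) i.rev.rev j = _
  rw [Fin.rev_rev]

/-- The leading principal `r × r` block of a matrix. -/
def lead {R : Type*} (A : Matrix (Fin n) (Fin n) R) (r : ℕ) (h : r ≤ n) :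
    Matrix (Fin r) (Fin r) R :=
  A.submatrix (Fin.castLE h) (Fin.castLE h)

theorem sum_eq_sum_castLE {M : Type*} [AddCommMonoid M] {r : ℕ} (h : r ≤ n) (F : Fin n → M)
    (hF : ∀ i : Fin n, r ≤ i → F i = 0) : ∑ i, F i = ∑ i : Fin r, F (Fin.castLE h i) := by
  symm
  refine Finset.sum_of_injOn (Fin.castLE h) (Fin.castLE_injective h).injOn (by simp) ?_
    (fun _ _ => rfl)
  intro i _ hi
  refine hF i ?_
  by_contra! hlt
  exact hi ⟨⟨i, hlt⟩, by simp, rfl⟩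

theorem lead_mul_of_lower {R : Type*} [CommRing R] {A : Matrix (Fin n) (Fin n) R}
    (hA : A.IsLowerTriangular) (B : Matrix (Fin n) (Fin n) R) (r : ℕ) (h : r ≤ n) :
    lead (A * B) r h = lead A r h * lead B r h := by
  ext i j
  simp only [lead, submatrix_apply, Matrix.mul_apply]
  refine sum_eq_sum_castLE h _ fun m hm => ?_
  have hlt : Fin.castLE h i < m := i.2.trans_le hm
  have h0 : A (Fin.castLE h i) m = 0 := hA hlt
  rw [h0, zero_mul]

theorem lead_mul_of_upper {R : Type*} [CommRing R] {B : Matrix (Fin n) (Fin n) R}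
    (hB : B.IsUpperTriangular) (A : Matrix (Fin n) (Fin n) R) (r : ℕ) (h : r ≤ n) :
    lead (A * B) r h = lead A r h * lead B r h := by
  ext i j
  simp only [lead, submatrix_apply, Matrix.mul_apply]
  refine sum_eq_sum_castLE h _ fun m hm => ?_
  have hlt : Fin.castLE h j < m := j.2.trans_le hm
  have h0 : B m (Fin.castLE h j) = 0 := hB hlt
  rw [h0, mul_zero]

theorem det_lead_of_lower {R : Type*} [CommRing R] {A : Matrix (Fin n) (Fin n) R}
    (hA : A.IsLowerTriangular) (r : ℕ) (h : r ≤ n) :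
    (lead A r h).det = ∏ i : Fin r, A (Fin.castLE h i) (Fin.castLE h i) :=
  det_of_isLowerTriangular _ fun i j (hij : i < j) => hA (show Fin.castLE h i < Fin.castLE h j from hij)

theorem det_lead_of_upper {R : Type*} [CommRing R] {A : Matrix (Fin n) (Fin n) R}
    (hA : A.IsUpperTriangular) (r : ℕ) (h : r ≤ n) :
    (lead A r h).det = ∏ i : Fin r, A (Fin.castLE h i) (Fin.castLE h i) :=
  det_of_isUpperTriangular fun i j (hij : j < i) => hA (show Fin.castLE h j < Fin.castLE h i from hij)

/-- If the leading principal minors of `A` do not vanish, then `A` becomes lower triangular after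
multiplication by some upper unipotent matrix. -/
theorem exists_unipotent_mul_lower {A : Matrix (Fin n) (Fin n) k}
    (hA : ∀ (r : ℕ) (h : r ≤ n), (lead A r h).det ≠ 0) :
    ∃ u : unipotent n k,
      (A * ((u : GL (Fin n) k) : Matrix (Fin n) (Fin n) k)).IsLowerTriangular := by
  -- The part of column `j` of `u` above the diagonal solves the `j × j` system that clears column
  -- `j` of `A * u` above the diagonal.
  set x : (j : Fin n) → Fin j → k := fun j =>
    (lead A j j.2.le)⁻¹ *ᵥ fun i => - A (Fin.castLE j.2.le i) j with hx
  have hsolve : ∀ (j i : Fin n) (hij : i < j),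
      ∑ m : Fin j, A i (Fin.castLE j.2.le m) * x j m = - A i j := by
    intro j i hij
    have h1 : lead A j j.2.le *ᵥ x j = fun i => - A (Fin.castLE j.2.le i) j := by
      rw [hx, mulVec_mulVec, mul_nonsing_inv _ (hA _ _).isUnit, one_mulVec]
    exact congrFun h1 ⟨i, hij⟩
  set Y : Matrix (Fin n) (Fin n) k := Matrix.of fun m j =>
    if h : m < j then x j ⟨m, h⟩ else 0 with hY
  have hYu : (Y + 1).IsUpperTriangular := by
    intro i j hij
    have hij : j < i := hij
    simp [hY, not_lt.2 hij.le, one_apply_ne hij.ne']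
  have hYd : ∀ i, (Y + 1) i i = 1 := fun i => by simp [hY]
  obtain ⟨b, hb⟩ := borel_of_upper hYu (fun i => by rw [hYd]; exact one_ne_zero)
  refine ⟨⟨b, b.2, fun i => by rw [hb, hYd]⟩, ?_⟩
  intro i j hij
  have hij : i < j := hij
  change (A * ((b : GL (Fin n) k) : Matrix (Fin n) (Fin n) k)) i j = 0
  rw [hb, mul_add, mul_one, Matrix.add_apply, Matrix.mul_apply,
    sum_eq_sum_castLE j.2.le _ (fun m hm => ?_)]
  · rw [← eq_neg_iff_add_eq_zero, ← hsolve j i hij]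
    refine Finset.sum_congr rfl fun m _ => ?_
    have : Fin.castLE j.2.le m < j := m.2
    simp [hY, this]
  · have : ¬ m < j := not_lt.2 hm
    simp [hY, this]

/-- The big cell `B w₀ U` contains every `g` for which the leading minors of `w₀ g` are nonzero. -/
theorem exists_eq_borel_mul_revGL_mul_unipotent {g : GL (Fin n) k}
    (hg : ∀ (r : ℕ) (h : r ≤ n),
      (lead ((g : Matrix (Fin n) (Fin n) k).submatrix Fin.rev id) r h).det ≠ 0) :
    ∃ (b : borel n k) (u : unipotent n k), g = b * (revGL n k * u) := by
  obtain ⟨u, hu⟩ := exists_unipotent_mul_lower hg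
  -- Since `w₀ g u` is lower triangular, reversing its rows and columns makes `g u w₀` upper
  -- triangular.
  refine ⟨⟨g * u * revGL n k, ?_⟩, u⁻¹, ?_⟩
  · intro i j hij
    have hij : j < i := hij
    rw [Units.val_mul, mul_revGL_apply, Units.val_mul]
    have hlt : i.rev < j.rev := Fin.rev_lt_rev.2 hij
    have h0 : ((g : Matrix (Fin n) (Fin n) k).submatrix Fin.rev id *
      ((u : GL (Fin n) k) : Matrix (Fin n) (Fin n) k)) i.rev j.rev = 0 := hu hlt
    rw [Matrix.mul_apply] at h0 ⊢
    rw [← h0]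
    refine Finset.sum_congr rfl fun m _ => ?_
    rw [submatrix_apply, Fin.rev_rev, id]
  · simp only [InvMemClass.coe_inv]
    rw [← mul_assoc, mul_assoc _ (revGL n k) (revGL n k), revGL_mul_revGL]
    simp

theorem evalMat_det_lead (A : Matrix (Fin n) (Fin n) k) (r : ℕ) (h : r ≤ n) :
    evalMat A (lead ((mvPolynomialX (Fin n) (Fin n) k).submatrix Fin.rev id) r h).det =
      (lead (A.submatrix Fin.rev id) r h).det := by
  rw [evalMat, RingHom.map_det]
  congr 1
  ext i j
  simp [lead]

/-- Density of the big cell. -/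
theorem eq_zero_of_vanishes_on_cell [Infinite k] {f : GL (Fin n) k → k} (hf : f ∈ algFun n k)
    (h : ∀ (b : borel n k) (u : unipotent n k), f (b * (revGL n k * u)) = 0) : f = 0 := by
  obtain ⟨N, P, hP⟩ := exists_mul_det_pow_eq hf
  set D : MvPolynomial (Fin n × Fin n) k := ∏ r : Fin (n + 1),
    (lead ((mvPolynomialX (Fin n) (Fin n) k).submatrix Fin.rev id) r (Nat.lt_succ_iff.1 r.2)).det
    with hD
  have hDe : ∀ A : Matrix (Fin n) (Fin n) k, evalMat A D = ∏ r : Fin (n + 1),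
      (lead (A.submatrix Fin.rev id) r (Nat.lt_succ_iff.1 r.2)).det := by
    intro A
    rw [hD, evalMat, map_prod]
    exact Finset.prod_congr rfl fun r _ => evalMat_det_lead A r _
  have hD0 : D ≠ 0 := by
    intro h0
    have h1 := hDe (revGL n k)
    rw [h0, evalMat, map_zero, revGL_submatrix] at h1
    refine Finset.prod_ne_zero_iff.2 (fun r _ => ?_) h1.symm
    rw [det_lead_of_upper blockTriangular_one]
    simp
  -- Where `D` is nonzero the matrix lies in the cell, so `P` vanishes there; `D` itself is nonzero
  -- because it takes the value 1 at `w₀`.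
  have hPD : P * D = 0 := by
    refine MvPolynomial.eq_of_eval_eq_on_gl fun g => ?_
    rw [map_mul, map_zero]
    change evalMat g P * evalMat g D = 0
    by_cases hg : evalMat g D = 0
    · rw [hg, mul_zero]
    · rw [hDe, Finset.prod_eq_zero_iff] at hg
      push Not at hg
      obtain ⟨b, u, hbu⟩ := exists_eq_borel_mul_revGL_mul_unipotent (g := g)
        fun r hr => hg ⟨r, Nat.lt_succ_iff.2 hr⟩ (Finset.mem_univ _)
      rw [← hP, hbu, h b u, zero_mul, zero_mul]
  have hP0 := (mul_eq_zero.1 hPD).resolve_right hD0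
  ext g
  have := hP g
  rw [hP0, evalMat, map_zero] at this
  exact (mul_eq_zero.1 this).resolve_right (pow_ne_zero _ g.det_ne_zero)

theorem eq_zero_of_vanishes_on_revGL_mul [Infinite k] {l : Fin n → ℤ} {f : GL (Fin n) k → k}
    (hf : f ∈ ind k l) (h : ∀ u : unipotent n k, f (revGL n k * u) = 0) : f = 0 :=
  eq_zero_of_vanishes_on_cell hf.1 fun b u => by rw [hf.2, h u, mul_zero]

end BigCell

/-! ### The highest weight vector -/

section HighestWeight

variable {n : ℕ} {k : Type*} [Field k]

/-- The minor of `g` on the last `r` rows and the first `r` columns, up to sign. -/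
def cellMinor (r : ℕ) (h : r ≤ n) (g : GL (Fin n) k) : k :=
  (lead ((g : Matrix (Fin n) (Fin n) k).submatrix Fin.rev id) r h).det

theorem cellMinor_mem (r : ℕ) (h : r ≤ n) : cellMinor (k := k) r h ∈ algFun n k := by
  have : cellMinor (k := k) r h = ∑ σ : Equiv.Perm (Fin r), ((Equiv.Perm.sign σ : ℤ) : k) •
      ∏ i, fun g : GL (Fin n) k =>
        (g : Matrix (Fin n) (Fin n) k) (Fin.castLE h (σ i)).rev (Fin.castLE h i) := by
    ext g
    simp [cellMinor, det_apply', lead]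
  rw [this]
  exact sum_mem fun σ _ => Subalgebra.smul_mem (algFun n k) (prod_mem fun i _ =>
    Algebra.subset_adjoin (Set.mem_union_left _
      ⟨((Fin.castLE h (σ i)).rev, Fin.castLE h i), rfl⟩)) _

theorem inv_cellMinor_mem {r : ℕ} (h : r ≤ n) (hr : r = n) :
    (fun g : GL (Fin n) k => (cellMinor r h g)⁻¹) ∈ algFun n k := by
  subst hr
  have : (fun g : GL (Fin r) k => (cellMinor r h g)⁻¹) =
      ((revGL r k : Matrix (Fin r) (Fin r) k).det)⁻¹ •
        fun g : GL (Fin r) k => ((g : Matrix (Fin r) (Fin r) k).det)⁻¹ := by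
    ext g
    have : cellMinor r h g = ((g : Matrix (Fin r) (Fin r) k).submatrix Fin.rev id).det := rfl
    rw [this, ← rev_submatrix_mul, det_mul, mul_inv]
    rfl
  rw [this]
  exact Subalgebra.smul_mem (algFun r k) (Algebra.subset_adjoin (Set.mem_union_right _ rfl)) _

theorem cellMinor_borel_mul (r : ℕ) (h : r ≤ n) (b : borel n k) (g : GL (Fin n) k) :
    cellMinor r h ((b : GL (Fin n) k) * g) =
      (∏ i : Fin r, ((b : GL (Fin n) k) : Matrix (Fin n) (Fin n) k)
        (Fin.castLE h i).rev (Fin.castLE h i).rev) * cellMinor r h g := by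
  have hL : ((((b : GL (Fin n) k) : Matrix (Fin n) (Fin n) k)).submatrix
      Fin.rev Fin.rev).IsLowerTriangular := fun i j (hij : i < j) =>
    b.2 (show j.rev < i.rev from Fin.rev_lt_rev.2 hij)
  have : ((b * g : GL (Fin n) k) : Matrix (Fin n) (Fin n) k).submatrix Fin.rev id =
      (((b : GL (Fin n) k) : Matrix (Fin n) (Fin n) k)).submatrix Fin.rev Fin.rev *
        (g : Matrix (Fin n) (Fin n) k).submatrix Fin.rev id := by
    rw [Units.val_mul]
    exact (submatrix_mul_equiv _ _ Fin.rev Fin.revPerm id).symm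
  rw [cellMinor, this, lead_mul_of_lower hL, det_mul, det_lead_of_lower hL]
  rfl

theorem cellMinor_mul_unipotent (r : ℕ) (h : r ≤ n) (u : unipotent n k) (g : GL (Fin n) k) :
    cellMinor r h (g * (u : GL (Fin n) k)) = cellMinor r h g := by
  have : ((g * u : GL (Fin n) k) : Matrix (Fin n) (Fin n) k).submatrix Fin.rev id =
      (g : Matrix (Fin n) (Fin n) k).submatrix Fin.rev id *
        ((u : GL (Fin n) k) : Matrix (Fin n) (Fin n) k) := by
    rw [Units.val_mul]
    rfl
  rw [cellMinor, this, lead_mul_of_upper u.2.1, det_mul, det_lead_of_upper u.2.1]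
  simp [u.2.2, cellMinor]

theorem cellMinor_revGL (r : ℕ) (h : r ≤ n) : cellMinor r h (revGL n k) = 1 := by
  rw [cellMinor, revGL_submatrix, det_lead_of_upper blockTriangular_one]
  simp

/-- Summation by parts, in multiplicative form: it turns the characters of the successive minors
into the character `l`. -/
theorem prod_range_prod_zpow (β : ℕ → k) (hβ : ∀ c, β c ≠ 0) (M : ℕ → ℤ) (N : ℕ) :
    ∏ a ∈ Finset.range N, (∏ c ∈ Finset.range (a + 1), β c) ^ (M a - M (a + 1)) =
      (∏ c ∈ Finset.range N, β c) ^ (- M N) * ∏ c ∈ Finset.range N, β c ^ M c := by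
  induction N with
  | zero => simp
  | succ N ih =>
    have h0 : ∏ c ∈ Finset.range N, β c ≠ 0 := Finset.prod_ne_zero_iff.2 fun c _ => hβ c
    rw [Finset.prod_range_succ, ih, Finset.prod_range_succ (fun c => β c ^ M c),
      Finset.prod_range_succ β, sub_eq_add_neg, mul_zpow, mul_zpow, zpow_add₀ h0,
      zpow_add₀ (hβ N), _root_.zpow_neg _ (M N)]
    have := zpow_ne_zero (M N) h0
    field_simp

/-- A tuple extended by zero and read backwards. -/
def revExtend (l : Fin n → ℤ) (a : ℕ) : ℤ := if h : a < n then l (Fin.rev ⟨a, h⟩) else 0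

/-- The highest weight vector, a product of powers of minors. -/
def highestVector (l : Fin n → ℤ) (g : GL (Fin n) k) : k :=
  ∏ a : Fin n, cellMinor (a + 1) a.2 g ^ (revExtend l a - revExtend l (a + 1))

theorem highestVector_mem_algFun {l : Fin n → ℤ} (hl : Monotone l) :
    highestVector (k := k) l ∈ algFun n k := by
  have : highestVector (k := k) l = ∏ a : Fin n, fun g : GL (Fin n) k =>
      cellMinor (a + 1) a.2 g ^ (revExtend l a - revExtend l (a + 1)) := by
    ext g
    simp [highestVector]
  rw [this]
  refine prod_mem fun a _ => ?_
  have hpow : ∀ m : ℕ, (fun g : GL (Fin n) k => cellMinor (a + 1) a.2 g ^ (m : ℤ)) ∈ algFun n k := by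
    intro m
    simp only [zpow_natCast]
    exact pow_mem (cellMinor_mem (a + 1) a.2) m
  rcases le_total 0 (revExtend l a - revExtend l (a + 1)) with h | h
  · obtain ⟨m, hm⟩ := Int.eq_ofNat_of_zero_le h
    rw [hm]
    exact hpow m
  · by_cases ha : (a : ℕ) + 1 < n
    · have h1 : revExtend l (a + 1) ≤ revExtend l a := by
        rw [revExtend, revExtend, dif_pos ha, dif_pos a.2]
        refine hl (Fin.rev_le_rev.2 ?_)
        rw [Fin.le_def]
        simp
      rw [le_antisymm h (by omega)]
      exact hpow 0
    -- Only the last exponent, equal to `l 0`, may be negative; its minor is the full determinant up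
    -- to sign, whose inverse is algebraic.
    · obtain ⟨m, hm⟩ := Int.eq_ofNat_of_zero_le (neg_nonneg.2 h)
      rw [← neg_neg (revExtend l a - revExtend l (a + 1)), hm]
      simp only [_root_.zpow_neg, zpow_natCast, ← inv_pow]
      exact pow_mem (inv_cellMinor_mem (k := k) a.2 (by have := a.2; omega)) m

theorem highestVector_mem {l : Fin n → ℤ} (hl : Monotone l) : highestVector l ∈ ind k l := by
  refine ⟨highestVector_mem_algFun hl, fun b g => ?_⟩
  set β : ℕ → k := fun c => if h : c < n then ((b : GL (Fin n) k) : Matrix (Fin n) (Fin n) k)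
    (Fin.rev ⟨c, h⟩) (Fin.rev ⟨c, h⟩) else 1 with hβ
  have hdiag : ∀ i, ((b : GL (Fin n) k) : Matrix (Fin n) (Fin n) k) i i ≠ 0 := by
    have := (b : GL (Fin n) k).det_ne_zero
    rw [det_of_isUpperTriangular b.2] at this
    exact fun i => Finset.prod_ne_zero_iff.1 this i (Finset.mem_univ _)
  have hβ0 : ∀ c, β c ≠ 0 := by
    intro c
    simp only [hβ]
    split_ifs
    · exact hdiag _
    · exact one_ne_zero
  have key := prod_range_prod_zpow β hβ0 (revExtend l) n
  -- The value zero past the end removes the boundary term of the summation by parts.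
  have hn : revExtend l n = 0 := by simp [revExtend]
  rw [hn, neg_zero, zpow_zero, one_mul, Finset.prod_range, Finset.prod_range] at key
  have hchar : borelChar l b = ∏ c : Fin n, β c ^ revExtend l c := by
    change ∏ i, ((b : GL (Fin n) k) : Matrix (Fin n) (Fin n) k) i i ^ l i = _
    rw [← Equiv.prod_comp Fin.revPerm]
    refine Finset.prod_congr rfl fun c _ => ?_
    simp [hβ, revExtend]
  rw [hchar, ← key, highestVector, highestVector, ← Finset.prod_mul_distrib]
  refine Finset.prod_congr rfl fun a _ => ?_
  rw [cellMinor_borel_mul, mul_zpow, Finset.prod_range]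
  congr 2
  refine Finset.prod_congr rfl fun c _ => ?_
  have : (c : ℕ) < n := c.2.trans_le a.2
  simp only [hβ, this, dif_pos]
  rfl

theorem highestVector_mul_unipotent (l : Fin n → ℤ) (g : GL (Fin n) k) (u : unipotent n k) :
    highestVector l (g * (u : GL (Fin n) k)) = highestVector l g := by
  simp only [highestVector, cellMinor_mul_unipotent]

theorem highestVector_revGL (l : Fin n → ℤ) : highestVector l (revGL n k) = 1 := by
  simp [highestVector, cellMinor_revGL]

theorem highestVector_ne_zero {l : Fin n → ℤ} (hl : Monotone l) :
    (⟨highestVector l, highestVector_mem hl⟩ : ind k l) ≠ 0 := by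
  intro h
  have : highestVector l (revGL n k) = 0 := congrFun (congrArg Subtype.val h) (revGL n k)
  rw [highestVector_revGL] at this
  exact one_ne_zero this

/-- Both sides are constant on `w₀ U` and agree at `w₀`, hence on the big cell. -/
theorem eq_smul_highestVector [Infinite k] {l : Fin n → ℤ} (hl : Monotone l)
    {f : GL (Fin n) k → k} (hf : f ∈ ind k l)
    (hu : ∀ (g : GL (Fin n) k) (u : unipotent n k), f (g * u) = f g) :
    f = f (revGL n k) • highestVector l := by
  refine sub_eq_zero.1 (eq_zero_of_vanishes_on_revGL_mul
    (sub_mem hf (Submodule.smul_mem _ _ (highestVector_mem hl))) fun u => ?_)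
  simp [hu, highestVector_mul_unipotent, highestVector_revGL]

end HighestWeight

/-! ### Necessity of dominance -/

section Dominance

variable {n : ℕ} {k : Type*} [Field k]

/-- Reduces algebraicity along a parametrized family of matrices to its generators; used for curves
in `G` and for the slice `w₀ U`. -/
theorem comp_mem_of_entries_mem {X : Type*} (A : Subalgebra k (X → k)) {γ : X → GL (Fin n) k}
    (hγ : ∀ i j, (fun x => (γ x : Matrix (Fin n) (Fin n) k) i j) ∈ A)
    (hdet : (fun x => ((γ x : Matrix (Fin n) (Fin n) k).det)⁻¹) ∈ A)
    {f : GL (Fin n) k → k} (hf : f ∈ algFun n k) : (fun x => f (γ x)) ∈ A := by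
  induction hf using Algebra.adjoin_induction with
  | mem f hf =>
    rcases hf with ⟨x, rfl⟩ | rfl
    · exact hγ x.1 x.2
    · exact hdet
  | algebraMap r => exact A.algebraMap_mem r
  | add f f' _ _ h h' => exact A.add_mem h h'
  | mul f f' _ _ h h' => exact A.mul_mem h h'

variable (k) in
/-- The polynomial functions on the affine line. -/
def polyFun : Subalgebra k (k → k) where
  carrier := {F | ∃ p : Polynomial k, ∀ c, F c = p.eval c}
  mul_mem' := by
    rintro F G ⟨p, hp⟩ ⟨q, hq⟩
    exact ⟨p * q, fun c => by simp [hp, hq]⟩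
  add_mem' := by
    rintro F G ⟨p, hp⟩ ⟨q, hq⟩
    exact ⟨p + q, fun c => by simp [hp, hq]⟩
  algebraMap_mem' r := ⟨Polynomial.C r, fun c => by simp⟩

/-- Clearing denominators gives `X ^ (m + deg q) * p = q.reverse`, whose right side has degree at
most `deg q`. -/
theorem eq_zero_of_eval_mul_pow_eq_eval_inv [Infinite k] {p q : Polynomial k} {m : ℕ} (hm : 0 < m)
    (h : ∀ c : k, c ≠ 0 → c ^ m * p.eval c = q.eval c⁻¹) : p = 0 := by
  have key : Polynomial.X * (Polynomial.X ^ (m + q.natDegree) * p - q.reverse) = 0 := by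
    refine Polynomial.funext fun c => ?_
    by_cases hc : c = 0
    · simp [hc]
    · have hinv : Invertible c⁻¹ := invertibleOfNonzero (inv_ne_zero hc)
      have h1 := Polynomial.eval₂_reverse_mul_pow (RingHom.id k) c⁻¹ q
      rw [invOf_eq_inv, inv_inv] at h1
      change q.reverse.eval c * _ = q.eval c⁻¹ at h1
      rw [← h c hc] at h1
      have h2 : q.reverse.eval c = c ^ (m + q.natDegree) * p.eval c := by
        have hpow : (c⁻¹) ^ q.natDegree * c ^ q.natDegree = 1 := by
          rw [← mul_pow, inv_mul_cancel₀ hc, one_pow]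
        calc q.reverse.eval c = q.reverse.eval c * ((c⁻¹) ^ q.natDegree * c ^ q.natDegree) := by
              rw [hpow, mul_one]
          _ = _ := by rw [← mul_assoc, h1]; ring
      simp [h2]
  have h0 := sub_eq_zero.1 ((mul_eq_zero.1 key).resolve_left Polynomial.X_ne_zero)
  by_contra hp
  have h1 := congrArg Polynomial.natDegree h0
  rw [Polynomial.natDegree_X_pow_mul _ hp] at h1
  have h2 := Polynomial.reverse_natDegree_le q
  omega

/-- A transvection as an element of `GLₙ`. -/
def transGL {i j : Fin n} (hij : i ≠ j) (c : k) : GL (Fin n) k :=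
  GeneralLinearGroup.mkOfDetNeZero (transvection i j c) (by
    rw [det_transvection_of_ne i j hij]; exact one_ne_zero)

theorem transGL_val {i j : Fin n} (hij : i ≠ j) (c : k) :
    (transGL hij c : Matrix (Fin n) (Fin n) k) = transvection i j c := rfl

theorem transGL_entry_mem {i j : Fin n} (hij : i ≠ j) {φ : k → k} (hφ : φ ∈ polyFun k)
    (a b : Fin n) :
    (fun c => (transGL hij (φ c) : Matrix (Fin n) (Fin n) k) a b) ∈ polyFun k := by
  have : (fun c => (transGL hij (φ c) : Matrix (Fin n) (Fin n) k) a b) =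
      (fun _ => (1 : Matrix (Fin n) (Fin n) k) a b) + (if i = a ∧ j = b then (1 : k) else 0) • φ := by
    ext c
    by_cases h : i = a ∧ j = b <;> simp [transGL_val, transvection, h]
  rw [this]
  exact add_mem ((polyFun k).algebraMap_mem _) (Subalgebra.smul_mem _ hφ _)

theorem mul_entry_mem {X : Type*} (A : Subalgebra k (X → k)) {γ δ : X → GL (Fin n) k}
    (hγ : ∀ i j, (fun x => (γ x : Matrix (Fin n) (Fin n) k) i j) ∈ A)
    (hδ : ∀ i j, (fun x => (δ x : Matrix (Fin n) (Fin n) k) i j) ∈ A) (i j : Fin n) :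
    (fun x => ((γ x * δ x : GL (Fin n) k) : Matrix (Fin n) (Fin n) k) i j) ∈ A := by
  have : (fun x => ((γ x * δ x : GL (Fin n) k) : Matrix (Fin n) (Fin n) k) i j) =
      ∑ m, (fun x => (γ x : Matrix (Fin n) (Fin n) k) i m) *
        fun x => (δ x : Matrix (Fin n) (Fin n) k) m j := by
    ext x
    simp [Matrix.mul_apply]
  rw [this]
  exact sum_mem fun m _ => A.mul_mem (hγ i m) (hδ m j)

theorem const_entry_mem {X : Type*} (A : Subalgebra k (X → k)) (g : GL (Fin n) k) (i j : Fin n) :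
    (fun _ : X => (g : Matrix (Fin n) (Fin n) k) i j) ∈ A :=
  A.algebraMap_mem _

theorem exists_borel_mul_eq_transGL {i j : Fin n} (hij : i < j) {c : k} (hc : c ≠ 0)
    (l : Fin n → ℤ) : ∃ b : borel n k, borelChar l b = c ^ (l j - l i) ∧
      transGL hij.ne' c = (b : GL (Fin n) k) *
        (transGL hij.ne (-1) * transGL hij.ne' 1 * transGL hij.ne (c⁻¹ - 1)) := by
  -- In rows and columns `i, j` this is the block with rows `(c⁻¹, 1)` and `(0, c)`; the product of
  -- transvections it multiplies has rows `(0, -1)` and `(1, c⁻¹)`.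
  set C : Matrix (Fin n) (Fin n) k :=
    1 + single i i (c⁻¹ - 1) + single j j (c - 1) + single i j 1 with hC
  have hd : ∀ a, C a a = if a = i then c⁻¹ else if a = j then c else 1 := by
    intro a
    by_cases h : a = i
    · subst h
      simp [hC, hij.ne']
    · by_cases h' : a = j
      · subst h'
        simp [hC, hij.ne, hij.ne']
      · simp [hC, h, h', Ne.symm h, Ne.symm h']
  obtain ⟨b, hb⟩ := borel_of_upper (A := C)
    (by
      intro x y hxy
      have hxy : y < x := hxy
      have h1 : ¬ (i = x ∧ i = y) := by rintro ⟨rfl, rfl⟩; exact lt_irrefl _ hxy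
      have h2 : ¬ (j = x ∧ j = y) := by rintro ⟨rfl, rfl⟩; exact lt_irrefl _ hxy
      have h3 : ¬ (i = x ∧ j = y) := by rintro ⟨rfl, rfl⟩; exact lt_asymm hxy hij
      simp [hC, h1, h2, h3, one_apply_ne hxy.ne'])
    (by
      intro a
      rw [hd]
      split_ifs
      · exact inv_ne_zero hc
      · exact hc
      · exact one_ne_zero)
  refine ⟨b, ?_, ?_⟩
  · change ∏ a, ((b : GL (Fin n) k) : Matrix (Fin n) (Fin n) k) a a ^ l a = _
    rw [hb]
    simp only [hd]
    rw [Finset.prod_eq_mul i j hij.ne]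
    · simp only [if_true, if_neg hij.ne']
      rw [_root_.inv_zpow, zpow_sub₀ hc, div_eq_mul_inv, mul_comm]
    · rintro a - ⟨h1, h2⟩
      simp [h1, h2]
    · simp
    · simp
  · refine Units.ext ?_
    simp only [Units.val_mul, transGL_val, hb, hC, transvection]
    have hij' := hij.ne
    have hji' := hij.ne'
    simp only [mul_add, add_mul, mul_one, one_mul, single_mul_single_same,
      single_mul_single_of_ne _ _ _ _ hij', single_mul_single_of_ne _ _ _ _ hji', add_zero]
    ext x y
    simp only [Matrix.add_apply, single_apply]
    split_ifs <;> first | (exfalso; omega) | (field_simp; ring)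

/-- The curve `c ↦ f (x_{ji}(c) g)` is a polynomial in `c`, and the factorization through `B` writes
it as `c ^ (l j - l i)` times a polynomial in `c⁻¹`. The exponent is negative, so the curve
vanishes, in particular at `c = 0`. -/
theorem apply_eq_zero_of_lt [Infinite k] {l : Fin n → ℤ} {f : GL (Fin n) k → k} (hf : f ∈ ind k l)
    {i j : Fin n} (hij : i < j) (hl : l j < l i) (g : GL (Fin n) k) : f g = 0 := by
  have hid : (fun c : k => c) ∈ polyFun k := ⟨Polynomial.X, fun c => by simp⟩
  have hsub : (fun c : k => c - 1) ∈ polyFun k := ⟨Polynomial.X - 1, fun c => by simp⟩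
  have hdet : ∀ {a b : Fin n} (hab : a ≠ b) (c : k),
      (transGL hab c : Matrix (Fin n) (Fin n) k).det = 1 := fun hab c =>
    det_transvection_of_ne _ _ hab c
  obtain ⟨p, hp⟩ := comp_mem_of_entries_mem (polyFun k)
    (γ := fun c => transGL hij.ne' c * g)
    (mul_entry_mem _ (transGL_entry_mem _ hid) (const_entry_mem _ g))
    (by
      simp only [Units.val_mul, det_mul, hdet]
      exact (polyFun k).algebraMap_mem _) hf.1
  obtain ⟨q, hq⟩ := comp_mem_of_entries_mem (polyFun k)
    (γ := fun c => transGL hij.ne (-1) * transGL hij.ne' 1 * transGL hij.ne (c - 1) * g)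
    (mul_entry_mem _ (mul_entry_mem _ (const_entry_mem _ _) (transGL_entry_mem _ hsub))
      (const_entry_mem _ g))
    (by
      simp only [Units.val_mul, det_mul, hdet]
      exact (polyFun k).algebraMap_mem _) hf.1
  beta_reduce at hp hq
  obtain ⟨m, hm⟩ := Int.eq_ofNat_of_zero_le (sub_nonneg.2 hl.le)
  have hp0 : p = 0 := by
    refine eq_zero_of_eval_mul_pow_eq_eval_inv (q := q) (m := m) (by omega) fun c hc => ?_
    obtain ⟨b, hbl, hb⟩ := exists_borel_mul_eq_transGL hij hc l
    rw [← hp, ← hq, hb, mul_assoc, hf.2, hbl, ← mul_assoc, ← zpow_natCast, ← zpow_add₀ hc]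
    have : (m : ℤ) + (l j - l i) = 0 := by omega
    rw [this, zpow_zero, one_mul]
  have h0 : f (transGL hij.ne' 0 * g) = _ := hp 0
  rw [hp0, Polynomial.eval_zero] at h0
  have h1 : transGL (k := k) hij.ne' 0 = 1 := Units.ext (by simp [transGL_val, transvection])
  rwa [h1, one_mul] at h0

theorem monotone_of_nontrivial_ind [Infinite k] {l : Fin n → ℤ} (h : Nontrivial (ind k l)) :
    Monotone l := by
  by_contra hl
  rw [Monotone] at hl
  push Not at hl
  obtain ⟨i, j, hij, hlt⟩ := hl
  have hij' : i < j := lt_of_le_of_ne hij (by rintro rfl; exact lt_irrefl _ hlt)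
  obtain ⟨f, hf⟩ := exists_ne (0 : ind k l)
  exact hf (Subtype.ext (funext fun g => apply_eq_zero_of_lt f.2 hij' hlt g))

theorem nontrivial_ind_of_monotone {l : Fin n → ℤ} (hl : Monotone l) : Nontrivial (ind k l) :=
  ⟨⟨_, 0, highestVector_ne_zero hl⟩⟩

end Dominance

/-! ### Fixed vectors of the unipotent group -/

section FixedVectors

variable {n : ℕ} {k : Type*} [Field k]

/-- Polynomial functions on `U` of weighted degree at most `d`, where the coordinate `uᵢⱼ` has
weight `j - i`. -/
inductive HasDegreeLE : ℕ → (unipotent n k → k) → Prop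
  | const (c : k) : HasDegreeLE 0 fun _ => c
  | coord (i j : Fin n) (h : i < j) :
      HasDegreeLE (j - i) fun u => ((u : GL (Fin n) k) : Matrix (Fin n) (Fin n) k) i j
  | add {d : ℕ} {F G : unipotent n k → k} :
      HasDegreeLE d F → HasDegreeLE d G → HasDegreeLE d (F + G)
  | mul {d e : ℕ} {F G : unipotent n k → k} :
      HasDegreeLE d F → HasDegreeLE e G → HasDegreeLE (d + e) (F * G)
  | mono {d e : ℕ} {F : unipotent n k → k} : d ≤ e → HasDegreeLE d F → HasDegreeLE e F

namespace HasDegreeLE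

theorem sum {ι : Type*} (s : Finset ι) {d : ℕ} {F : ι → unipotent n k → k}
    (h : ∀ i ∈ s, HasDegreeLE d (F i)) : HasDegreeLE d (∑ i ∈ s, F i) := by
  classical
  induction s using Finset.induction_on with
  | empty => exact mono (Nat.zero_le d) (const 0)
  | insert i s hi ih =>
    rw [Finset.sum_insert hi]
    exact add (h i (Finset.mem_insert_self _ _)) (ih fun j hj => h j (Finset.mem_insert_of_mem hj))

theorem entry (i j : Fin n) {d : ℕ} (hd : (j : ℕ) - i ≤ d) :
    HasDegreeLE d fun u : unipotent n k => ((u : GL (Fin n) k) : Matrix (Fin n) (Fin n) k) i j := by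
  rcases lt_trichotomy i j with h | h | h
  · exact mono hd (coord i j h)
  · subst h
    have : (fun u : unipotent n k => ((u : GL (Fin n) k) : Matrix (Fin n) (Fin n) k) i i) =
        fun _ => 1 := funext fun u => u.2.2 i
    rw [this]
    exact mono (Nat.zero_le d) (const 1)
  · have : (fun u : unipotent n k => ((u : GL (Fin n) k) : Matrix (Fin n) (Fin n) k) i j) =
        fun _ => 0 := funext fun u => u.2.1 h
    rw [this]
    exact mono (Nat.zero_le d) (const 0)

/-- Right translation changes a function only by terms of lower degree. -/
theorem translate {d : ℕ} {F : unipotent n k → k} (hF : HasDegreeLE d F) (v : unipotent n k) :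
    (fun u => F (u * v)) = F ∨ (0 < d ∧ HasDegreeLE (d - 1) ((fun u => F (u * v)) - F)) := by
  induction hF with
  | const c => exact Or.inl rfl
  | coord i j h =>
    refine Or.inr ⟨Nat.sub_pos_of_lt h, ?_⟩
    have : ((fun u : unipotent n k =>
        (((u * v : unipotent n k) : GL (Fin n) k) : Matrix (Fin n) (Fin n) k) i j) -
        fun u : unipotent n k => ((u : GL (Fin n) k) : Matrix (Fin n) (Fin n) k) i j) =
        ∑ m ∈ Finset.univ.erase j, (fun u : unipotent n k =>
          ((u : GL (Fin n) k) : Matrix (Fin n) (Fin n) k) i m) *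
          fun _ => ((v : GL (Fin n) k) : Matrix (Fin n) (Fin n) k) m j := by
      ext u
      rw [Pi.sub_apply, Finset.sum_apply, Subgroup.coe_mul, Units.val_mul, Matrix.mul_apply,
        ← Finset.add_sum_erase _ _ (Finset.mem_univ j), v.2.2 j, mul_one, add_sub_cancel_left]
      rfl
    rw [this]
    refine sum _ fun m hm => ?_
    rcases lt_or_gt_of_ne (Finset.ne_of_mem_erase hm) with hmj | hmj
    -- For `m < j` the coordinate `u i m` has smaller weight than `u i j`, and the entries of `v`
    -- are constants.
    · refine mul (d := (j : ℕ) - i - 1) (e := 0) (entry i m ?_) (const _)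
      have := Fin.lt_def.1 hmj
      omega
    · have h0 : ((v : GL (Fin n) k) : Matrix (Fin n) (Fin n) k) m j = 0 := v.2.1 hmj
      rw [h0]
      refine mono (Nat.zero_le _) ?_
      convert const (n := n) (k := k) 0 using 1
      ext u
      simp
  | @add d F G hF hG ihF ihG =>
    have hsplit : (fun u => (F + G) (u * v)) - (F + G) =
        ((fun u => F (u * v)) - F) + ((fun u => G (u * v)) - G) := by
      ext u; simp only [Pi.add_apply, Pi.sub_apply]; ring
    rcases ihF with ihF | ⟨hd, ihF⟩
    · rcases ihG with ihG | ⟨hd, ihG⟩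
      · left
        refine sub_eq_zero.1 ?_
        rw [hsplit, ihF, ihG]; simp
      · right
        rw [hsplit, ihF, sub_self, zero_add]
        exact ⟨hd, ihG⟩
    · right
      refine ⟨hd, ?_⟩
      rcases ihG with ihG | ⟨-, ihG⟩
      · rw [hsplit, ihG, sub_self, add_zero]
        exact ihF
      · rw [hsplit]
        exact add ihF ihG
  | @mul d e F G hF hG ihF ihG =>
    have hsplit : (fun u => (F * G) (u * v)) - (F * G) =
        ((fun u => F (u * v)) - F) * (fun u => G (u * v)) + F * ((fun u => G (u * v)) - G) := by
      ext u; simp only [Pi.add_apply, Pi.sub_apply, Pi.mul_apply]; ring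
    rcases ihF with ihF | ⟨hd, ihF⟩
    · rcases ihG with ihG | ⟨he, ihG⟩
      · left
        refine sub_eq_zero.1 ?_
        rw [hsplit, ihF, ihG]; simp
      · right
        refine ⟨by omega, ?_⟩
        rw [hsplit, ihF, sub_self, zero_mul, zero_add]
        exact mono (by omega) (mul hF ihG)
    · right
      refine ⟨by omega, ?_⟩
      rcases ihG with ihG | ⟨he, ihG⟩
      · rw [hsplit, ihG, sub_self, mul_zero, add_zero]
        exact mono (by omega) (mul ihF hG)
      · rw [hsplit]
        have hGv : HasDegreeLE e fun u => G (u * v) := by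
          have := add (mono (Nat.sub_le e 1) ihG) hG
          rwa [sub_add_cancel] at this
        exact add (mono (by omega) (mul ihF hGv)) (mono (by omega) (mul hF ihG))
  | @mono d e F hde hF ih =>
    rcases ih with ih | ⟨hd, ih⟩
    · exact Or.inl ih
    · exact Or.inr ⟨by omega, mono (by omega) ih⟩

end HasDegreeLE

variable (n k) in
/-- The polynomial functions on `U`. -/
def unipotentFun : Subalgebra k (unipotent n k → k) where
  carrier := {F | ∃ d, HasDegreeLE d F}
  mul_mem' := by
    rintro F G ⟨d, hd⟩ ⟨e, he⟩
    exact ⟨d + e, hd.mul he⟩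
  add_mem' := by
    rintro F G ⟨d, hd⟩ ⟨e, he⟩
    exact ⟨d + e, (hd.mono (Nat.le_add_right d e)).add (he.mono (Nat.le_add_left e d))⟩
  algebraMap_mem' r := ⟨0, .const r⟩

theorem exists_hasDegreeLE {f : GL (Fin n) k → k} (hf : f ∈ algFun n k) :
    ∃ d, HasDegreeLE d fun u : unipotent n k => f (revGL n k * u) := by
  refine comp_mem_of_entries_mem (unipotentFun n k)
    (γ := fun u : unipotent n k => revGL n k * (u : GL (Fin n) k)) (fun i j => ?_) ?_ hf
  · simp only [Units.val_mul, revGL_mul_apply]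
    exact ⟨_, .entry i.rev j le_rfl⟩
  · have : ∀ u : unipotent n k, ((u : GL (Fin n) k) : Matrix (Fin n) (Fin n) k).det = 1 := by
      intro u
      rw [det_of_isUpperTriangular u.2.1]
      simp [u.2.2]
    simp only [Units.val_mul, det_mul, this]
    exact (unipotentFun n k).algebraMap_mem _

/-- Every nonzero submodule of `Ind_B^G l` contains a nonzero `U`-fixed vector. -/
theorem exists_fixed_vector [Infinite k] {l : Fin n → ℤ} (L : Subrepresentation (indRep k l))
    (hL : L.toSubmodule ≠ ⊥) : ∃ f ∈ L.toSubmodule, f ≠ 0 ∧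
      ∀ (g : GL (Fin n) k) (u : unipotent n k), f.1 (g * (u : GL (Fin n) k)) = f.1 g := by
  classical
  have hex : ∃ d, ∃ f ∈ L.toSubmodule, f ≠ 0 ∧
      HasDegreeLE d fun u : unipotent n k => f.1 (revGL n k * (u : GL (Fin n) k)) := by
    obtain ⟨f, hf, hf0⟩ := Submodule.exists_mem_ne_zero_of_ne_bot hL
    obtain ⟨d, hd⟩ := exists_hasDegreeLE f.2.1
    exact ⟨d, f, hf, hf0, hd⟩
  -- Take a nonzero vector of least degree bound on `w₀ U`; a nonzero difference `v f - f` would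
  -- have a smaller one.
  obtain ⟨f, hf, hf0, hd⟩ := Nat.find_spec hex
  refine ⟨f, hf, hf0, fun g v => ?_⟩
  set f' : ind k l := indRep k l (v : GL (Fin n) k) f - f with hf'
  have hmem : f' ∈ L.toSubmodule := sub_mem (L.apply_mem_toSubmodule _ hf) hf
  have hval : ∀ x, f'.1 x = f.1 (x * (v : GL (Fin n) k)) - f.1 x := fun x => rfl
  suffices h : f' = 0 by
    have := hval g
    rw [h] at this
    exact sub_eq_zero.1 this.symm
  by_contra hne
  rcases hd.translate v with h | ⟨hpos, h⟩
  · refine hne (Subtype.ext (eq_zero_of_vanishes_on_revGL_mul f'.2 fun u => ?_))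
    rw [hval, mul_assoc]
    exact sub_eq_zero.2 (congrFun h u)
  · refine Nat.find_min hex (m := Nat.find hex - 1) (by omega) ⟨f', hmem, hne, ?_⟩
    convert h using 1
    ext u
    rw [hval, mul_assoc]
    rfl

theorem highestVector_mem_subrepresentation [Infinite k] {l : Fin n → ℤ} (hl : Monotone l)
    (L : Subrepresentation (indRep k l)) (hL : L.toSubmodule ≠ ⊥) :
    (⟨highestVector l, highestVector_mem hl⟩ : ind k l) ∈ L.toSubmodule := by
  obtain ⟨f, hf, hf0, hfix⟩ := exists_fixed_vector L hL
  have heq := eq_smul_highestVector hl f.2 hfix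
  have hc : f.1 (revGL n k) ≠ 0 := by
    intro h0
    rw [h0, zero_smul] at heq
    exact hf0 (Subtype.ext heq)
  have : (⟨highestVector l, highestVector_mem hl⟩ : ind k l) = (f.1 (revGL n k))⁻¹ • f := by
    refine Subtype.ext ?_
    rw [Submodule.coe_smul]
    conv_rhs => rw [heq]
    rw [smul_smul]
    simp [highestVector_revGL, hc]
  rw [this]
  exact Submodule.smul_mem _ _ hf

theorem finrank_submodule_eq_one {V : Type*} [AddCommGroup V] [Module k V] {S : Submodule k V}
    {v : V} (hv : v ∈ S) (hv0 : v ≠ 0) (h : ∀ w ∈ S, ∃ c : k, c • v = w) :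
    Module.finrank k S = 1 :=
  finrank_eq_one_iff'.2 ⟨⟨v, hv⟩, fun h0 => hv0 (congrArg Subtype.val h0), fun w =>
    (h w w.2).imp fun _ hc => Subtype.ext hc⟩

theorem finrank_invariants [Infinite k] {l : Fin n → ℤ} (hl : Monotone l) :
    Module.finrank k (Representation.invariants
      ((indRep k l).comp (unipotent n k).subtype)) = 1 := by
  refine finrank_submodule_eq_one (V := ind k l)
    (v := ⟨highestVector l, highestVector_mem hl⟩) (fun u => ?_) (highestVector_ne_zero hl)
    fun f hf => ?_
  · exact Subtype.ext (funext fun g => highestVector_mul_unipotent l g u)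
  · refine ⟨f.1 (revGL n k), Subtype.ext ?_⟩
    exact (eq_smul_highestVector hl f.2 fun g u =>
      congrFun (congrArg Subtype.val (hf u)) g).symm

end FixedVectors

/-! ### The unique irreducible submodule -/

section Socle

variable {k G V : Type*} [Field k] [Monoid G] [AddCommGroup V] [Module k V]
  {ρ : Representation k G V}

/-- If some nonzero vector lies in every nonzero subrepresentation, then there is exactly one
irreducible subrepresentation. -/
theorem existsUnique_irreducible_of_forall_mem {v : V} (hv : v ≠ 0)
    (h : ∀ L : Subrepresentation ρ, L.toSubmodule ≠ ⊥ → v ∈ L.toSubmodule) :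
    ∃! L : Subrepresentation ρ,
      Representation.IsIrreducible (k := k) (V := L.toSubmodule) L.toRepresentation := by
  -- The subrepresentation generated by `v`.
  set L₀ : Subrepresentation ρ :=
    { toSubmodule := sInf {W | v ∈ W ∧ ∀ g, ∀ w ∈ W, ρ g w ∈ W}
      apply_mem_toSubmodule := fun g w hw => by
        rw [Submodule.mem_sInf] at hw ⊢
        exact fun W hW => hW.2 g w (hw W hW) } with hL₀
  have hvL₀ : v ∈ L₀.toSubmodule := Submodule.mem_sInf.2 fun W hW => hW.1
  have hle : ∀ L : Subrepresentation ρ, v ∈ L.toSubmodule → L₀.toSubmodule ≤ L.toSubmodule :=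
    fun L hL => sInf_le ⟨hL, fun g w hw => L.apply_mem_toSubmodule g hw⟩
  refine ⟨L₀, ?_, fun L hL => ?_⟩
  · refine { exists_pair_ne := ⟨⊥, ⊤, fun hbt => ?_⟩, eq_bot_or_eq_top := fun M => ?_ }
    · have h1 : (⟨v, hvL₀⟩ : L₀.toSubmodule) ∈
          (⊤ : Subrepresentation L₀.toRepresentation).toSubmodule := Submodule.mem_top
      rw [← hbt] at h1
      exact hv (congrArg Subtype.val ((Submodule.mem_bot k).1 h1))
    · by_cases hM : M.toSubmodule = ⊥
      · exact Or.inl (Subrepresentation.toSubmodule_injective hM)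
      · right
        -- Viewed in `V`, a nonzero subrepresentation of `L₀` contains `v`, hence all of `L₀`.
        set M' : Subrepresentation ρ :=
          { toSubmodule := M.toSubmodule.map L₀.toSubmodule.subtype
            apply_mem_toSubmodule := by
              rintro g _ ⟨w, hw, rfl⟩
              exact ⟨_, M.apply_mem_toSubmodule g hw, rfl⟩ } with hM'
        have hM'0 : M'.toSubmodule ≠ ⊥ := fun h0 => hM
          (Submodule.map_injective_of_injective L₀.toSubmodule.subtype_injective
            (h0.trans (Submodule.map_bot _).symm))
        refine Subrepresentation.toSubmodule_injective (eq_top_iff.2 fun w _ => ?_)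
        obtain ⟨w', hw', hww'⟩ := hle M' (h M' hM'0) w.2
        rwa [← Subtype.ext (a1 := w') (a2 := w) hww']
  · have hL0 : L.toSubmodule ≠ ⊥ := by
      intro h0
      have hsub : Subsingleton L.toSubmodule := by rw [h0]; infer_instance
      have : (⊥ : Subrepresentation L.toRepresentation) = ⊤ :=
        Subrepresentation.toSubmodule_injective (Subsingleton.elim _ _)
      exact bot_ne_top this
    have hvL := h L hL0
    -- The intersection of `L₀` with `L` contains `v`, so irreducibility of `L` makes it everything.
    set M : Subrepresentation L.toRepresentation :=
      { toSubmodule := L₀.toSubmodule.comap L.toSubmodule.subtype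
        apply_mem_toSubmodule := fun g w hw => L₀.apply_mem_toSubmodule g hw } with hM
    have hMtop : M = ⊤ := by
      refine (eq_bot_or_eq_top M).resolve_left fun h0 => hv ?_
      have h1 : (⟨v, hvL⟩ : L.toSubmodule) ∈ M.toSubmodule := hvL₀
      rw [h0] at h1
      exact congrArg Subtype.val ((Submodule.mem_bot k).1 h1)
    refine Subrepresentation.toSubmodule_injective (le_antisymm (fun w hw => ?_) (hle L hvL))
    have h1 : (⟨w, hw⟩ : L.toSubmodule) ∈ M.toSubmodule := by
      rw [hMtop]; exact Submodule.mem_top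
    exact h1

end Socle

/-! ### The longest element of the Weyl group -/

section WeylGroup

variable {n : ℕ} {k : Type*} [Field k]

theorem exists_torus {d : Fin n → k} (hd : ∀ i, d i ≠ 0) :
    ∃ t : torus n k, ((t : GL (Fin n) k) : Matrix (Fin n) (Fin n) k) = diagonal d :=
  ⟨⟨GeneralLinearGroup.mkOfDetNeZero (diagonal d) (by
    rw [det_diagonal]; exact Finset.prod_ne_zero_iff.2 fun i _ => hd i), isDiag_diagonal d⟩, rfl⟩

theorem torusChar_apply (m : Fin n → ℤ) (t : torus n k) :
    torusChar m t = ∏ i, ((t : GL (Fin n) k) : Matrix (Fin n) (Fin n) k) i i ^ m i := rfl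

theorem exists_torus_update (i : Fin n) {s : k} (hs : s ≠ 0) :
    ∃ t : torus n k, (∀ j, ((t : GL (Fin n) k) : Matrix (Fin n) (Fin n) k) j j =
      if j = i then s else 1) ∧ ∀ m : Fin n → ℤ, torusChar m t = s ^ m i := by
  obtain ⟨t, ht⟩ := exists_torus (d := fun j : Fin n => if j = i then s else 1) (by
    intro j
    split_ifs
    · exact hs
    · exact one_ne_zero)
  refine ⟨t, fun j => by rw [ht, diagonal_apply_eq], fun m => ?_⟩
  rw [torusChar_apply, ht, Finset.prod_eq_single i]
  · simp
  · intro b _ hb; simp [hb]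
  · simp

theorem torusChar_injective [Infinite k] :
    Function.Injective (torusChar : (Fin n → ℤ) → torus n k →* k) := by
  intro m m' h
  by_contra hne
  obtain ⟨i, hi⟩ := Function.ne_iff.1 hne
  obtain ⟨s, hs0, hs⟩ := exists_zpow_ne_one (k := k) (sub_ne_zero.2 hi)
  obtain ⟨t, -, ht⟩ := exists_torus_update i hs0
  have h1 := DFunLike.congr_fun h t
  rw [ht, ht] at h1
  rw [zpow_sub₀ hs0, h1, div_self (zpow_ne_zero _ hs0)] at hs
  exact hs rfl

theorem torus_apply_ne (t : torus n k) (i : Fin n) :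
    ((t : GL (Fin n) k) : Matrix (Fin n) (Fin n) k) i i ≠ 0 := by
  have := (t : GL (Fin n) k).det_ne_zero
  rw [det_of_isUpperTriangular (diag_upper t.2)] at this
  exact Finset.prod_ne_zero_iff.1 this i (Finset.mem_univ _)

theorem torusChar_root (a b : Fin n) (t : torus n k) :
    torusChar (Pi.single a 1 - Pi.single b 1) t =
      ((t : GL (Fin n) k) : Matrix (Fin n) (Fin n) k) a a *
        (((t : GL (Fin n) k) : Matrix (Fin n) (Fin n) k) b b)⁻¹ := by
  rw [torusChar_apply]
  simp only [Pi.sub_apply, zpow_sub₀ (torus_apply_ne t _), Finset.prod_div_distrib]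
  rw [div_eq_mul_inv, Finset.prod_eq_single a, Finset.prod_eq_single b]
  · simp
  · intro c _ hc; simp [hc]
  · simp
  · intro c _ hc; simp [hc]
  · simp

theorem revGL_mem_normalizer :
    revGL n k ∈ Subgroup.normalizer (torus n k : Set (GL (Fin n) k)) := by
  have key : ∀ t : GL (Fin n) k, t ∈ torus n k →
      revGL n k * t * (revGL n k)⁻¹ ∈ torus n k := by
    intro t ht i j hij
    rw [revGL_inv, Units.val_mul, mul_revGL_apply, Units.val_mul, revGL_mul_apply]
    exact ht fun h => hij (Fin.rev_injective h)
  rw [Subgroup.mem_normalizer_iff]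
  refine fun t => ⟨key t, fun h => ?_⟩
  have := key _ h
  rw [revGL_inv] at this
  simpa only [mul_assoc, revGL_mul_revGL, mul_one, ← mul_assoc (revGL n k) (revGL n k),
    one_mul] using this

theorem weylAct_mk_apply (x : Subgroup.normalizer (torus n k : Set (GL (Fin n) k)))
    (t : torus n k) : ∃ t' : torus n k,
      (t' : GL (Fin n) k) = (x : GL (Fin n) k)⁻¹ * t * x ∧
      ∀ χ : torus n k →* k, weylAct (QuotientGroup.mk x : Weyl n k) χ t = χ t' :=
  ⟨weylConj (QuotientGroup.mk x : Weyl n k)⁻¹ t, by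
    change ((x⁻¹ : Subgroup.normalizer (torus n k : Set (GL (Fin n) k))) : GL (Fin n) k) * t *
      ((x⁻¹ : Subgroup.normalizer (torus n k : Set (GL (Fin n) k))) : GL (Fin n) k)⁻¹ = _
    simp, fun _ => rfl⟩

variable (n k) in
/-- The longest element of the Weyl group. -/
def longest : Weyl n k := QuotientGroup.mk ⟨revGL n k, revGL_mem_normalizer⟩

theorem weylAct_longest (m : Fin n → ℤ) :
    weylAct (longest n k) (torusChar m) = torusChar fun i => m i.rev := by
  ext t
  obtain ⟨t', ht', h⟩ := weylAct_mk_apply ⟨revGL n k, revGL_mem_normalizer⟩ t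
  rw [longest, h, torusChar_apply, torusChar_apply, ht', ← Equiv.prod_comp Fin.revPerm]
  refine Finset.prod_congr rfl fun i _ => ?_
  rw [revGL_inv, Units.val_mul, mul_revGL_apply, Units.val_mul, revGL_mul_apply]
  simp

theorem isLongest_longest : IsLongest (longest n k) := by
  rintro _ ⟨i, j, hij, rfl⟩
  refine ⟨j.rev, i.rev, Fin.rev_lt_rev.2 hij, ?_⟩
  rw [weylAct_longest]
  congr 1
  ext a
  simp [Pi.single_apply, Fin.rev_eq_iff]

theorem eq_id_of_strictMono {σ : Fin n → Fin n} (h : StrictMono σ) (i : Fin n) : σ i = i :=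
  le_antisymm h.apply_le h.le_apply

/-- A representative in the normalizer is a monomial matrix, with permutation `σ`, and sends the
root of `(i, j)` to that of `(σ i, σ j)`. Negativity of the images makes `σ` order-reversing, and
`Fin n` has only one such self-map. -/
theorem eq_longest [Infinite k] {w : Weyl n k} (hw : IsLongest w) : w = longest n k := by
  induction w using QuotientGroup.induction_on with
  | H x =>
  set A : Matrix (Fin n) (Fin n) k := ((x : GL (Fin n) k) : Matrix (Fin n) (Fin n) k) with hA
  have hcol : ∀ b, ∃ a, A a b ≠ 0 := by
    intro b
    by_contra! h
    exact (x : GL (Fin n) k).det_ne_zero (det_eq_zero_of_column_eq_zero b h)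
  choose σ hσ using hcol
  have hconj : ∀ t t' : torus n k, (t' : GL (Fin n) k) = (x : GL (Fin n) k)⁻¹ * t * x →
      ∀ a b, A a b ≠ 0 → ((t' : GL (Fin n) k) : Matrix (Fin n) (Fin n) k) b b =
        ((t : GL (Fin n) k) : Matrix (Fin n) (Fin n) k) a a := by
    intro t t' ht a b hab
    have h1 : A * ((t' : GL (Fin n) k) : Matrix (Fin n) (Fin n) k) =
        ((t : GL (Fin n) k) : Matrix (Fin n) (Fin n) k) * A := by
      rw [hA, ← Units.val_mul, ← Units.val_mul, ht]
      congr 1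
      group
    have h2 := congrFun (congrFun h1 a) b
    have ht1 : ((t : GL (Fin n) k) : Matrix (Fin n) (Fin n) k).IsDiag := t.2
    have ht2 : ((t' : GL (Fin n) k) : Matrix (Fin n) (Fin n) k).IsDiag := t'.2
    rw [← ht1.diagonal_diag, ← ht2.diagonal_diag, mul_diagonal, diagonal_mul, mul_comm] at h2
    exact mul_right_cancel₀ hab h2
  have hsupp : ∀ a b, A a b ≠ 0 → a = σ b := by
    intro a b hab
    by_contra hne
    -- Two nonzero entries in column `b` would force every torus element to agree in positions `a`
    -- and `σ b`; one with `s ≠ 1` only at `a` does not.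
    obtain ⟨s, hs0, hs1⟩ := exists_zpow_ne_one (k := k) one_ne_zero
    obtain ⟨t, ht, -⟩ := exists_torus_update a hs0
    obtain ⟨t', ht', -⟩ := weylAct_mk_apply x t
    have h1 := hconj t t' ht' a b hab
    rw [hconj t t' ht' (σ b) b (hσ b), ht, ht, if_neg (Ne.symm hne), if_pos rfl] at h1
    rw [zpow_one] at hs1
    exact hs1 h1.symm
  have hanti : ∀ i j, i < j → σ j < σ i := by
    intro i j hij
    obtain ⟨p, q, hpq, hroot⟩ := hw _ ⟨i, j, hij, rfl⟩
    have h1 : weylAct (QuotientGroup.mk x : Weyl n k) (torusChar (Pi.single i 1 - Pi.single j 1)) =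
        torusChar (Pi.single (σ i) 1 - Pi.single (σ j) 1) := by
      ext t
      obtain ⟨t', ht', h⟩ := weylAct_mk_apply x t
      rw [h, torusChar_root, torusChar_root, hconj t t' ht' _ _ (hσ i), hconj t t' ht' _ _ (hσ j)]
    have h2 := torusChar_injective (h1.symm.trans hroot)
    -- A root has coefficient `1` at only one index and `-1` at only one, which identifies `q` with
    -- `σ i` and `p` with `σ j`.
    have hq := congrFun h2 q
    have hp := congrFun h2 p
    simp only [Pi.sub_apply, Pi.single_apply, if_neg hpq.ne, if_neg hpq.ne', if_true] at hq hp
    have hqi : q = σ i := by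
      by_contra h
      rw [if_neg h] at hq
      split_ifs at hq <;> omega
    have hpj : p = σ j := by
      by_contra h
      rw [if_neg h] at hp
      split_ifs at hp <;> omega
    rwa [← hqi, ← hpj]
  have hrev : ∀ b, σ b = b.rev := fun b => Fin.rev_eq_iff.1
    (eq_id_of_strictMono (σ := fun b => (σ b).rev) (fun i j h => Fin.rev_lt_rev.2 (hanti i j h)) b)
  refine Eq.symm (QuotientGroup.eq.2 ?_)
  rw [Subgroup.mem_subgroupOf]
  change (revGL n k)⁻¹ * (x : GL (Fin n) k) ∈ torus n k
  intro a b hab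
  rw [revGL_inv, Units.val_mul, revGL_mul_apply]
  by_contra h
  exact hab (Fin.rev_injective ((hsupp _ _ h).trans (hrev b)))

theorem isDominant_longest_iff [Infinite k] {l : Fin n → ℤ} :
    IsDominant (weylAct (longest n k) (torusChar l)) ↔ Monotone l := by
  rw [weylAct_longest]
  constructor
  · rintro ⟨m, hm, h⟩ i j hij
    have := hm (Fin.rev_le_rev.2 hij)
    rw [← torusChar_injective h] at this
    simpa using this
  · exact fun h => ⟨_, fun i j hij => h (Fin.rev_le_rev.2 hij), rfl⟩

end WeylGroup

end GLInd

end

theorem mainTheorem7 (p : ℕ) [Fact p.Prime] (k : Type*) [Field k] [Algebra (ZMod p) k]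
    [IsAlgClosure (ZMod p) k] (n : ℕ) (l : Fin n → ℤ) :
    -- (1) finite dimension, and the criterion for being nonzero through the element `w₀` of `W`
    Module.Finite k (GLInd.ind k l) ∧
    (∃ w₀ : GLInd.Weyl n k,
      GLInd.IsLongest w₀ ∧ (∀ w : GLInd.Weyl n k, GLInd.IsLongest w → w = w₀) ∧
      GLInd.weylAct w₀ (GLInd.torusChar l) = GLInd.torusChar (fun i => l i.rev) ∧
      (Nontrivial (GLInd.ind k l) ↔
        GLInd.IsDominant (GLInd.weylAct w₀ (GLInd.torusChar l)))) ∧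
    -- (2) the `U`-fixed vectors form a line
    (Nontrivial (GLInd.ind k l) →
      Module.finrank k (Representation.invariants
        ((GLInd.indRep k l).comp (GLInd.unipotent n k).subtype)) = 1) ∧
    -- (3) there is exactly one irreducible submodule
    (Nontrivial (GLInd.ind k l) →
      ∃! L : Subrepresentation (GLInd.indRep k l),
        Representation.IsIrreducible (k := k) (V := L.toSubmodule) L.toRepresentation) := by
  have : IsAlgClosed k := IsAlgClosure.isAlgClosed (ZMod p)
  have : Infinite k := IsAlgClosed.instInfinite
  refine ⟨GLInd.finite_ind l, ⟨GLInd.longest n k, GLInd.isLongest_longest,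
    fun w hw => GLInd.eq_longest hw, GLInd.weylAct_longest l, ?_⟩, fun h => ?_, fun h => ?_⟩
  · rw [GLInd.isDominant_longest_iff]
    exact ⟨GLInd.monotone_of_nontrivial_ind, GLInd.nontrivial_ind_of_monotone⟩
  · exact GLInd.finrank_invariants (GLInd.monotone_of_nontrivial_ind h)
  · have hl := GLInd.monotone_of_nontrivial_ind h
    exact GLInd.existsUnique_irreducible_of_forall_mem
      (GLInd.highestVector_ne_zero hl)
      (GLInd.highestVector_mem_subrepresentation hl)
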